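/- Let $W$ be a standard Brownian motion, and let $S_0,\sigma,\delta>0$ be known constants. Let $\Theta\subseteq\mathbb R^K$ be open and let $g(v;\theta),h(v;\theta)$, $\theta\in\Theta$, be permanent and temporary impact functions. In the Almgren–Chriss model, an order with trading rate $v$ and duration $T$ has the price $$S_t=S_0+S_0\bigl(g(v;\theta)t+h(v;\theta)\bigr)+S_0\sigma W_t\quad(0<t\le T),\qquad S_t=S_0+S_0\,g(v;\theta)T+S_0\sigma W_t\quad(t>T).$$ Put $P_t=(S_t-S_0)/S_0$, $T_{\rm post}=T+\delta$, $I=P_{T_{\rm post}}$ (permanent impact) and $J=\frac1T\int_0^TP_t\,dt$ (realized impact). The pair $(v,T)$ has a distribution $G_{\rm order}$ that does not depend on $\theta$ and is independent of $W$. Assume that $T_L\le T\le T_U$ a.s. for some constants $0<T_L\le T_U<\infty$, that $g,h$ are measurable in $v$, that for almost every $(v,T)$ they are continuously differentiable in $\theta$, and that every $\theta\in\Theta$ has a neighbourhood on which $g(v;\cdot),h(v;\cdot)$ are Lipschitz with one constant valid for almost every $(v,T)$. For a statistic $X$, $\mathcal I_X(\theta)=\mathbb E_\theta\bigl[(\partial_\theta\log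 p_\theta)(\partial_\theta\log p_\theta)^{\top}\bigr]$ denotes the Fisher information matrix of the experiment in which $(v,T)$ and $X$ are observed, $p_\theta$ being the density of $((v,T),X)$ with respect to $G_{\rm order}\otimes$ Lebesgue measure, in a version that is continuously differentiable in $\theta$ for almost every sample point; $A\succcurlyeq B$ means that $A-B$ is positive semidefinite. (1) Let $\tau\in(0,\frac14]$ be fixed and $t=\tau T$. Then for every $\theta\in\Theta$ both Fisher information matrices below exist and $$\mathcal I_{P_t,P_T,P_{T_{\rm post}}}(\theta)\succcurlyeq\mathcal I_{I,J}(\theta).$$ This holds for all $g,h$ and all distributions $G_{\rm order}$ as above. (2) The constant $\frac14$ is tight: for every $\tau\in(\frac14,1)$, with $t=\tau T$, and all $v_0,T_0>0$, there are impact functions $g,h$ with parameter set $\Theta=\mathbb R^2$ such that, with $G_{\rm order}$ the point mass at $(v_0,T_0)$, all the assumptions above hold, the parameter is identifiable, both Fisher information matrices exist, do not depend on $\theta$ and are nonsingular, but $\mathcal I_{P_t,P_T,P_{T_{\rm post}}}(\theta)\succcurlyeq\mathcal I_{I,J}(\theta)$ fails for every $\theta$. -/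

import Mathlib

open MeasureTheory ProbabilityTheory Topology
open scoped NNReal

namespace AlmgrenChriss

noncomputable section

/-! ### Fisher information of a statistical experiment -/

/-- `p` is a likelihood of the experiment `(P θ)`, `θ ∈ Θ`, with respect to the reference
measure `ν` (which does not depend on `θ`): every `p θ` is a density of `P θ`, and almost every
sample point has a likelihood that is continuously differentiable in the parameter. -/
structure IsLikelihood {K : ℕ} {𝓧 : Type*} [MeasurableSpace 𝓧] (ν : Measure 𝓧)
    (P : EuclideanSpace ℝ (Fin K) → Measure 𝓧) (Θ : Set (EuclideanSpace ℝ (Fin K)))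
    (p : EuclideanSpace ℝ (Fin K) → 𝓧 → ℝ) : Prop where
  measurable : ∀ θ ∈ Θ, Measurable (p θ)
  nonneg : ∀ θ ∈ Θ, ∀ x, 0 ≤ p θ x
  density : ∀ θ ∈ Θ, P θ = ν.withDensity fun x => ENNReal.ofReal (p θ x)
  contDiff : ∀ᵐ x ∂ν, ContDiffOn ℝ 1 (fun θ => p θ x) Θ

/-- The `i`-th component `∂/∂θ_i log p_θ(x)` of the score. -/
def score {K : ℕ} {𝓧 : Type*} (p : EuclideanSpace ℝ (Fin K) → 𝓧 → ℝ)
    (θ : EuclideanSpace ℝ (Fin K)) (i : Fin K) (x : 𝓧) : ℝ :=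
  fderiv ℝ (fun θ' => Real.log (p θ' x)) θ (EuclideanSpace.single i 1)

/-- `I` is the Fisher information matrix `𝔼_θ[score · scoreᵀ]` at `θ` of the experiment
`(P θ)`, `θ ∈ Θ`: the experiment has a likelihood, and for every choice of the likelihood the
entries of `score · scoreᵀ` are `P θ`-integrable with expectations the entries of `I`. -/
def HasFisherInformation {K : ℕ} {𝓧 : Type*} [MeasurableSpace 𝓧] (ν : Measure 𝓧)
    (P : EuclideanSpace ℝ (Fin K) → Measure 𝓧) (Θ : Set (EuclideanSpace ℝ (Fin K)))
    (θ : EuclideanSpace ℝ (Fin K)) (I : Matrix (Fin K) (Fin K) ℝ) : Prop :=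
  (∃ p, IsLikelihood ν P Θ p) ∧
  ∀ p, IsLikelihood ν P Θ p → ∀ i j,
    Integrable (fun x => score p θ i x * score p θ j x) (P θ) ∧
    I i j = ∫ x, score p θ i x * score p θ j x ∂(P θ)

/-! ### The Almgren–Chriss price dynamics -/

/-- The stock price `S_t` of an order with trading rate `v` and duration `T`, along the path `w`
of the driving Brownian motion. -/
def stockPrice (S₀ σ : ℝ) (g h : ℝ → ℝ) (w : ℝ≥0 → ℝ) (v T t : ℝ) : ℝ :=
  if t ≤ T then S₀ + S₀ * (g v * t + h v) + S₀ * σ * w t.toNNReal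
  else S₀ + S₀ * (g v * T) + S₀ * σ * w t.toNNReal

/-- The normalized price `P_t = (S_t - S₀) / S₀`. -/
def price (S₀ σ : ℝ) (g h : ℝ → ℝ) (w : ℝ≥0 → ℝ) (v T t : ℝ) : ℝ :=
  (stockPrice S₀ σ g h w v T t - S₀) / S₀

/-- The permanent impact `I = P_{T_post}`, with `T_post = T + δ`. -/
def permanentImpact (S₀ σ δ : ℝ) (g h : ℝ → ℝ) (w : ℝ≥0 → ℝ) (v T : ℝ) : ℝ :=
  price S₀ σ g h w v T (T + δ)

/-- The realized impact `J = (1/T) ∫₀ᵀ P_t dt`. -/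
def realizedImpact (S₀ σ : ℝ) (g h : ℝ → ℝ) (w : ℝ≥0 → ℝ) (v T : ℝ) : ℝ :=
  (1 / T) * ∫ t in (0 : ℝ)..T, price S₀ σ g h w v T t

/-- The three prices `(P_t, P_T, P_{T_post})` with `t = τ T`. -/
def threePrices (S₀ σ δ τ : ℝ) (g h : ℝ → ℝ) (w : ℝ≥0 → ℝ) (v T : ℝ) : Fin 3 → ℝ :=
  ![price S₀ σ g h w v T (τ * T), price S₀ σ g h w v T T, price S₀ σ g h w v T (T + δ)]

/-- The pair `(I, J)` of permanent and realized impact. -/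
def impactPair (S₀ σ δ : ℝ) (g h : ℝ → ℝ) (w : ℝ≥0 → ℝ) (v T : ℝ) : Fin 2 → ℝ :=
  ![permanentImpact S₀ σ δ g h w v T, realizedImpact S₀ σ g h w v T]

/-! ### The experiments -/

/-- The law of `((v, T), X)` when `(v, T)` is drawn from `G`, independently of the driving
Brownian motion `W` under `μ`, and `X` is the statistic `stat` of the path of `W` and `(v, T)`. -/
def sampleLaw {Ω : Type*} [MeasurableSpace Ω] (μ : Measure Ω) (W : ℝ≥0 → Ω → ℝ)
    (G : Measure (ℝ × ℝ)) {n : ℕ} (stat : (ℝ≥0 → ℝ) → ℝ → ℝ → Fin n → ℝ) :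
    Measure ((ℝ × ℝ) × (Fin n → ℝ)) :=
  (G.prod μ).map fun z => (z.1, stat (fun s => W s z.2) z.1.1 z.1.2)

/-- `I` is the Fisher information at `θ` of the experiment in which the order characteristics
`(v, T)` and the three prices `(P_{τT}, P_T, P_{T+δ})` are observed. The reference measure is the
product of `G` and Lebesgue measure. -/
def IsFisherThreePrices {Ω : Type*} [MeasurableSpace Ω] (μ : Measure Ω) (W : ℝ≥0 → Ω → ℝ)
    (S₀ σ δ τ : ℝ) (G : Measure (ℝ × ℝ)) {K : ℕ} (Θ : Set (EuclideanSpace ℝ (Fin K)))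
    (g h : EuclideanSpace ℝ (Fin K) → ℝ → ℝ) (θ : EuclideanSpace ℝ (Fin K))
    (I : Matrix (Fin K) (Fin K) ℝ) : Prop :=
  HasFisherInformation (G.prod volume)
    (fun θ' => sampleLaw μ W G (threePrices S₀ σ δ τ (g θ') (h θ'))) Θ θ I

/-- `I` is the Fisher information at `θ` of the experiment in which the order characteristics
`(v, T)` and the permanent and realized impact `(I, J)` are observed. The reference measure is the
product of `G` and Lebesgue measure. -/
def IsFisherImpactPair {Ω : Type*} [MeasurableSpace Ω] (μ : Measure Ω) (W : ℝ≥0 → Ω → ℝ)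
    (S₀ σ δ : ℝ) (G : Measure (ℝ × ℝ)) {K : ℕ} (Θ : Set (EuclideanSpace ℝ (Fin K)))
    (g h : EuclideanSpace ℝ (Fin K) → ℝ → ℝ) (θ : EuclideanSpace ℝ (Fin K))
    (I : Matrix (Fin K) (Fin K) ℝ) : Prop :=
  HasFisherInformation (G.prod volume)
    (fun θ' => sampleLaw μ W G (impactPair S₀ σ δ (g θ') (h θ'))) Θ θ I

/-- The regularity assumptions on the impact functions `g(v; θ)`, `h(v; θ)`, `θ ∈ Θ`, and on the
distribution `G` of `(v, T)`: the parameter set is open, durations are bounded and bounded away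
from zero, and `g`, `h` are measurable in `v`, continuously differentiable in `θ`, and locally
Lipschitz in `θ`, uniformly in `v`. -/
structure RegularModel {K : ℕ} (Θ : Set (EuclideanSpace ℝ (Fin K)))
    (g h : EuclideanSpace ℝ (Fin K) → ℝ → ℝ) (G : Measure (ℝ × ℝ)) : Prop where
  isOpen : IsOpen Θ
  duration_bounds : ∃ T_L T_U : ℝ, 0 < T_L ∧ ∀ᵐ a ∂G, T_L ≤ a.2 ∧ a.2 ≤ T_U
  measurable_g : ∀ θ ∈ Θ, Measurable (g θ)
  measurable_h : ∀ θ ∈ Θ, Measurable (h θ)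
  contDiff_g : ∀ᵐ a ∂G, ContDiffOn ℝ 1 (fun θ => g θ a.1) Θ
  contDiff_h : ∀ᵐ a ∂G, ContDiffOn ℝ 1 (fun θ => h θ a.1) Θ
  lipschitz : ∀ θ ∈ Θ, ∃ U ∈ 𝓝 θ, ∃ L : ℝ, ∀ᵐ a ∂G, ∀ θ₁ ∈ U, ∀ θ₂ ∈ U,
    |g θ₁ a.1 - g θ₂ a.1| ≤ L * ‖θ₁ - θ₂‖ ∧ |h θ₁ a.1 - h θ₂ a.1| ≤ L * ‖θ₁ - θ₂‖

/-- Different parameters give different impact functions. -/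
def Identifiable {K : ℕ} (Θ : Set (EuclideanSpace ℝ (Fin K)))
    (g h : EuclideanSpace ℝ (Fin K) → ℝ → ℝ) (G : Measure (ℝ × ℝ)) : Prop :=
  ∀ θ₁ ∈ Θ, ∀ θ₂ ∈ Θ,
    (∀ᵐ a ∂G, g θ₁ a.1 = g θ₂ a.1 ∧ h θ₁ a.1 = h θ₂ a.1) → θ₁ = θ₂

end

end AlmgrenChriss

open AlmgrenChriss

/-!
# Fisher information of sampled prices and of impact statistics in the Almgren–Chriss model

Given the order `(v, T)`, both statistics are Gaussian vectors whose means are linear in `(g, h)` and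
whose covariances do not depend on the parameter. A unimodular change of coordinates makes the
noises independent:

* for `(P_t, P_T, P_{T_post})`, passing to increments gives means `τ T g + h`, `(1 - τ) T g`, `-h`
  and variances `σ² τ T`, `σ² (1 - τ) T`, `σ² δ`;
* for `(I, J)`, the pair `(I - (3/2) J, J)` has means `(T/4) g - (3/2) h`, `(T/2) g + h` and
  variances `σ² (T/4 + δ)`, `σ² T/3`, because `W_{T+δ}` and `(1/T) ∫₀ᵀ W` are jointly Gaussian with
  variances `T + δ`, `T/3` and covariance `T/2`. The last fact comes from Riemann sums
  (`integral_exp_eval_add_average_brownian`).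

Such an experiment is called a Gaussian regression below (`IsGaussianRegression`). Its density is an
explicit product of normal densities, its score is linear in the noise, and its Fisher information
matrix is the average over orders of `∑ k, (∂ᵢ mean k) (∂ⱼ mean k) / variance k`
(`IsGaussianRegression.hasFisherInformation`). Any other likelihood has the same score almost
everywhere, by continuity in the parameter (`IsLikelihood.score_ae_eq`).

Comparing the two matrices is then a comparison of quadratic forms in the directional derivatives
`u` of `g` and `w` of `h`, order by order, and completing the square (`informationForm_sub`) shows
that `σ²` times the difference of the forms is
`δ T / (T + 4 δ) * (u + (T - 2 δ) / (δ T) * w)² + (1 / τ - 4) / T * w²`.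
It is nonnegative for `τ ≤ 1 / 4`. For `τ > 1 / 4` it is negative where the first square vanishes,
and in the model with `g = θ₀`, `h = θ₁` the directions `(u, w)` are arbitrary.
-/

namespace AlmgrenChriss

/-! ### Gaussian laws and densities -/

/-- A product of nondegenerate real Gaussian measures has the product density. -/
lemma pi_gaussianReal_eq_withDensity {n : ℕ} (m : Fin n → ℝ) (c : Fin n → ℝ≥0)
    (hc : ∀ k, c k ≠ 0) :
    Measure.pi (fun k => gaussianReal (m k) (c k)) =
      volume.withDensity fun y : Fin n → ℝ =>
        ENNReal.ofReal (∏ k, gaussianPDFReal (m k) (c k) (y k)) := by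
  refine Measure.pi_eq (μ := fun k => gaussianReal (m k) (c k)) fun s hs => ?_
  rw [withDensity_apply _ (MeasurableSet.univ_pi hs)]
  have hind : ∀ y : Fin n → ℝ,
      (Set.univ.pi s).indicator
        (fun y : Fin n → ℝ => ∏ k, gaussianPDFReal (m k) (c k) (y k)) y =
        ∏ k, (s k).indicator (gaussianPDFReal (m k) (c k)) (y k) := by
    intro y
    by_cases hy : y ∈ Set.univ.pi s
    · rw [Set.indicator_of_mem hy]
      exact Finset.prod_congr rfl fun k _ => by
        rw [Set.indicator_of_mem (hy k (Set.mem_univ k))]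
    · rw [Set.indicator_of_notMem hy]
      simp only [Set.mem_pi, Set.mem_univ, true_imp_iff, not_forall] at hy
      obtain ⟨k, hk⟩ := hy
      exact (Finset.prod_eq_zero (Finset.mem_univ k) (Set.indicator_of_notMem hk _)).symm
  rw [← ofReal_integral_eq_lintegral_ofReal, ← integral_indicator (MeasurableSet.univ_pi hs)]
  · simp_rw [hind]
    rw [integral_fintype_prod_volume_eq_prod (fun k => (s k).indicator
      (gaussianPDFReal (m k) (c k))), ENNReal.ofReal_prod_of_nonneg]
    · refine Finset.prod_congr rfl fun k _ => ?_
      rw [integral_indicator (hs k), gaussianReal_apply_eq_integral _ (hc k)]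
    · intro k _
      exact integral_nonneg fun x => Set.indicator_nonneg
        (fun x _ => gaussianPDFReal_nonneg _ _ x) x
  · exact (Integrable.fintype_prod fun k => integrable_gaussianPDFReal (m k) (c k)).integrableOn
  · exact ae_of_all _ fun y => Finset.prod_nonneg fun k _ => gaussianPDFReal_nonneg _ _ _

/-- A random vector all of whose linear combinations have the characteristic function of a
centered Gaussian with variance `∑ k, t k ^ 2 * c k` has independent Gaussian coordinates. -/
lemma map_eq_pi_gaussianReal_of_charFun {Ω : Type*} [MeasurableSpace Ω] {μ : Measure Ω}
    [IsProbabilityMeasure μ] {n : ℕ} {N : Ω → Fin n → ℝ} (hN : Measurable N) (c : Fin n → ℝ≥0)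
    (h : ∀ t : Fin n → ℝ, ∫ ω, Complex.exp (((∑ k, t k * N ω k : ℝ) : ℂ) * Complex.I) ∂μ =
      Complex.exp (-((∑ k, t k ^ 2 * c k : ℝ) : ℂ) / 2)) :
    μ.map N = Measure.pi fun k => gaussianReal 0 (c k) := by
  have : IsProbabilityMeasure (μ.map N) := Measure.isProbabilityMeasure_map hN.aemeasurable
  rw [← charFun_eq_pi_iff]
  intro t
  rw [Measure.map_map (by fun_prop) hN, charFun_apply,
    integral_map (by fun_prop) (by fun_prop)]
  simp_rw [charFun_gaussianReal, ← Complex.exp_sum]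
  convert h t using 2
  · simp [PiLp.inner_apply]
  · simp [Finset.sum_div, neg_div, ← Finset.sum_neg_distrib, mul_comm]

/-! ### Brownian motion: continuous version, linear combinations and time averages -/

/-- A Brownian motion agrees, off a null set of paths, with a process that is measurable at every
time and all of whose paths are continuous. -/
lemma exists_measurable_continuous_version {Ω : Type*} [MeasurableSpace Ω] {μ : Measure Ω}
    {W : ℝ≥0 → Ω → ℝ} (hW : IsBrownianReal W μ) :
    ∃ V : ℝ≥0 → Ω → ℝ, (∀ s, Measurable (V s)) ∧ (∀ ω, Continuous fun s => V s ω) ∧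
      ∀ᵐ ω ∂μ, ∀ s, W s ω = V s ω := by
  classical
  obtain ⟨D, hDc, hDd⟩ := TopologicalSpace.exists_countable_dense ℝ≥0
  have hae : ∀ᵐ ω ∂μ, Continuous (W · ω) ∧ ∀ q : D, W q ω = (hW.aemeasurable q).mk (W q) ω := by
    have := hDc.to_subtype
    exact hW.cont.and (ae_all_iff.2 fun q => (hW.aemeasurable q).ae_eq_mk)
  obtain ⟨A, hA, hAm, hAμ⟩ := exists_measurable_superset_of_null (ae_iff.1 hae)
  have hgood : ∀ ω ∉ A, Continuous (W · ω) ∧ ∀ q : D, W q ω = (hW.aemeasurable q).mk (W q) ω :=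
    fun ω hω => not_not.1 fun h => hω (hA h)
  refine ⟨fun s ω => Aᶜ.indicator (W s) ω, fun s => ?_, fun ω => ?_, ?_⟩
  · have hD : ∀ q ∈ D, Measurable (Aᶜ.indicator (W q)) := by
      intro q hq
      have : Aᶜ.indicator (W q) = Aᶜ.indicator ((hW.aemeasurable q).mk (W q)) :=
        Set.indicator_congr fun ω hω => (hgood ω hω).2 ⟨q, hq⟩
      rw [this]
      exact (hW.aemeasurable q).measurable_mk.indicator hAm.compl
    obtain ⟨q, hqD, hqs⟩ := mem_closure_iff_seq_limit.1 (hDd s)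
    refine measurable_of_tendsto_metrizable (fun n => hD (q n) (hqD n))
      (tendsto_pi_nhds.2 fun ω => ?_)
    by_cases hω : ω ∈ A
    · simp [hω]
    · simpa [hω, Function.comp_def] using ((hgood ω hω).1.tendsto s).comp hqs
  · by_cases hω : ω ∈ A
    · simpa [hω] using continuous_const
    · simpa [hω] using (hgood ω hω).1
  · filter_upwards [measure_eq_zero_iff_ae_notMem.1 hAμ] with ω hω s
    simp [hω]

/-- The law of a linear combination of values of a Brownian motion. -/
lemma map_linearCombination_brownian {Ω : Type*} [MeasurableSpace Ω] {μ : Measure Ω}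
    {W : ℝ≥0 → Ω → ℝ} (hW : IsPreBrownianReal W μ) {ι : Type*} [Fintype ι] (t : ι → ℝ≥0)
    (c : ι → ℝ) :
    μ.map (fun ω => ∑ i, c i * W (t i) ω) =
      gaussianReal 0 (∑ i, ∑ j, c i * c j * (min (t i) (t j) : ℝ≥0)).toNNReal := by
  have hprob := hW.isGaussianProcess.isProbabilityMeasure
  have hG : IsGaussianProcess (fun i ω => c i • W (t i) ω) μ :=
    (hW.isGaussianProcess.comp_right t).smul c
  have hL : HasGaussianLaw (fun ω => ∑ i, c i * W (t i) ω) μ :=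
    hG.hasGaussianLaw_fun_sum (I := Finset.univ)
  have hmem : ∀ i, MemLp (fun ω => c i * W (t i) ω) 2 μ := fun i =>
    (hG.hasGaussianLaw_eval i).memLp_two
  rw [hL.map_eq_gaussianReal, variance_fun_sum hmem,
    integral_finsetSum _ fun i _ => (hmem i).integrable (by norm_num)]
  congr 2
  · refine Finset.sum_eq_zero fun i _ => ?_
    rw [integral_const_mul, hW.integral_eval, mul_zero]
  · refine Finset.sum_congr rfl fun i _ => Finset.sum_congr rfl fun j _ => ?_
    rw [covariance_const_mul_left, covariance_const_mul_right, hW.covariance_fun_eval]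
    ring

/-- The characteristic function of a linear combination of values of a Brownian motion. -/
lemma integral_exp_linearCombination_brownian {Ω : Type*} [MeasurableSpace Ω] {μ : Measure Ω}
    {W : ℝ≥0 → Ω → ℝ} (hW : IsPreBrownianReal W μ) {ι : Type*} [Fintype ι] (t : ι → ℝ≥0)
    (c : ι → ℝ) :
    ∫ ω, Complex.exp (((∑ i, c i * W (t i) ω : ℝ) : ℂ) * Complex.I) ∂μ =
      Complex.exp (-((∑ i, ∑ j, c i * c j * (min (t i) (t j) : ℝ≥0) : ℝ) : ℂ) / 2) := by
  have hprob := hW.isGaussianProcess.isProbabilityMeasure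
  have hmeas : AEMeasurable (fun ω => ∑ i, c i * W (t i) ω) μ :=
    Finset.aemeasurable_fun_sum _ fun i _ => (hW.aemeasurable (t i)).const_mul (c i)
  have hnn : 0 ≤ ∑ i, ∑ j, c i * c j * (min (t i) (t j) : ℝ≥0) := by
    have hmem : ∀ i, MemLp (fun ω => c i * W (t i) ω) 2 μ := fun i =>
      ((hW.isGaussianProcess.hasGaussianLaw_eval (t i)).memLp_two).const_mul (c i)
    have h := variance_nonneg (fun ω => ∑ i, c i * W (t i) ω) μ
    rw [variance_fun_sum hmem] at h
    convert h using 4 with i _ j _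
    rw [covariance_const_mul_left, covariance_const_mul_right, hW.covariance_fun_eval]
    ring
  have h := charFun_gaussianReal (μ := 0)
    (v := (∑ i, ∑ j, c i * c j * (min (t i) (t j) : ℝ≥0)).toNNReal) 1
  rw [← map_linearCombination_brownian hW, charFun_apply_real,
    integral_map hmeas (by fun_prop)] at h
  rw [show ((Real.toNNReal (∑ i, ∑ j, c i * c j * (min (t i) (t j) : ℝ≥0)) : ℝ≥0) : ℂ) =
    ((∑ i, ∑ j, c i * c j * (min (t i) (t j) : ℝ≥0) : ℝ) : ℂ) by
      rw [← Complex.ofReal_inj.2 (Real.coe_toNNReal _ hnn)]] at h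
  simpa [neg_div] using h

/-- Left Riemann sums of a continuous function converge to its integral. -/
lemma tendsto_riemannSum {f : ℝ → ℝ} (hf : Continuous f) :
    Filter.Tendsto (fun n : ℕ => ∑ k ∈ Finset.range (n + 1), (1 / ((n : ℝ) + 1)) * f (k / (n + 1)))
      Filter.atTop (𝓝 (∫ s in (0 : ℝ)..1, f s)) := by
  rw [Metric.tendsto_atTop]
  intro ε hε
  have huc : UniformContinuousOn f (Set.Icc 0 1) :=
    isCompact_Icc.uniformContinuousOn_of_continuous hf.continuousOn
  obtain ⟨d, hd, hfd⟩ := Metric.uniformContinuousOn_iff.1 huc (ε / 2) (by positivity)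
  obtain ⟨n₀, hn₀⟩ := exists_nat_one_div_lt hd
  refine ⟨n₀, fun n hn => ?_⟩
  have hn1 : (0 : ℝ) < n + 1 := by positivity
  have hnd : 1 / ((n : ℝ) + 1) < d := by
    refine lt_of_le_of_lt ?_ hn₀
    gcongr
  have hsplit : ∫ s in (0 : ℝ)..1, f s =
      ∑ k ∈ Finset.range (n + 1), ∫ s in ((k : ℝ) / (n + 1))..(((k + 1 : ℕ) : ℝ) / (n + 1)), f s := by
    rw [intervalIntegral.sum_integral_adjacent_intervals
      (a := fun k : ℕ => (k : ℝ) / (n + 1)) fun k _ => hf.intervalIntegrable _ _]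
    congr 1
    · simp
    · push_cast
      rw [div_self hn1.ne']
  rw [dist_comm, hsplit, Real.dist_eq, ← Finset.sum_sub_distrib]
  have hterm : ∀ k ∈ Finset.range (n + 1),
      |(∫ s in ((k : ℝ) / (n + 1))..(((k + 1 : ℕ) : ℝ) / (n + 1)), f s) -
        (1 / ((n : ℝ) + 1)) * f (k / (n + 1))| ≤ ε / 2 * (1 / (n + 1)) := by
    intro k hk
    have hk' : (k : ℝ) + 1 ≤ n + 1 := by
      have := Finset.mem_range.1 hk
      exact_mod_cast this
    have hlen : (((k + 1 : ℕ) : ℝ) / (n + 1)) - (k : ℝ) / (n + 1) = 1 / (n + 1) := by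
      push_cast; ring
    have hconst : (1 / ((n : ℝ) + 1)) * f (k / (n + 1)) =
        ∫ s in ((k : ℝ) / (n + 1))..(((k + 1 : ℕ) : ℝ) / (n + 1)), f (k / (n + 1)) := by
      rw [intervalIntegral.integral_const, hlen, smul_eq_mul]
    rw [hconst, ← intervalIntegral.integral_sub (hf.intervalIntegrable _ _)
      (intervalIntegrable_const), ← Real.norm_eq_abs]
    have hle : (k : ℝ) / (n + 1) ≤ ((k + 1 : ℕ) : ℝ) / (n + 1) := by
      push_cast; gcongr; linarith
    refine (intervalIntegral.norm_integral_le_of_norm_le_const (C := ε / 2) fun s hs => ?_).trans ?_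
    · rw [Set.uIoc_of_le hle] at hs
      have h0 : (0 : ℝ) ≤ k / (n + 1) := by positivity
      have h1 : ((k + 1 : ℕ) : ℝ) / (n + 1) ≤ 1 := by
        rw [div_le_one hn1]; push_cast; exact hk'
      rw [← dist_eq_norm]
      refine (hfd s ⟨by linarith [hs.1], by linarith [hs.2]⟩ _ ⟨h0, by linarith⟩ ?_).le
      rw [Real.dist_eq, abs_of_pos (by linarith [hs.1])]
      linarith [hs.2]
    · rw [hlen, abs_of_pos (by positivity)]
  calc _ ≤ ∑ k ∈ Finset.range (n + 1), ε / 2 * (1 / ((n : ℝ) + 1)) :=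
        (Finset.abs_sum_le_sum_abs _ _).trans (Finset.sum_le_sum hterm)
    _ = ε / 2 := by
        rw [Finset.sum_const, Finset.card_range, nsmul_eq_mul]; push_cast; field_simp
    _ < ε := by linarith

lemma sum_range_sum_range_min (n : ℕ) :
    ∑ k ∈ Finset.range n, ∑ l ∈ Finset.range n, (min (k : ℝ) l) =
      n * (n - 1) * (2 * n - 1) / 6 := by
  induction n with
  | zero => simp
  | succ n ih =>
    have h1 : ∀ k ∈ Finset.range n, min (k : ℝ) n = k := fun k hk =>
      min_eq_left (by exact_mod_cast (Finset.mem_range.1 hk).le)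
    have h2 : ∀ k ∈ Finset.range n, min (n : ℝ) k = k := fun k hk =>
      min_eq_right (by exact_mod_cast (Finset.mem_range.1 hk).le)
    have h3 : ∀ n : ℕ, ∑ k ∈ Finset.range n, (k : ℝ) = n * (n - 1) / 2 := by
      intro n
      induction n with
      | zero => simp
      | succ n ih => rw [Finset.sum_range_succ, ih]; push_cast; ring
    simp only [Finset.sum_range_succ, Finset.sum_add_distrib]
    rw [Finset.sum_congr rfl h1, Finset.sum_congr rfl h2, ih, h3, min_self]
    push_cast
    ring

/-- The value of a Brownian motion at a time `S ≥ T` and its average over `[0, T]` are jointly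
Gaussian with variances `S`, `T / 3` and covariance `T / 2`: the average is a limit of Riemann
sums. -/
lemma integral_exp_eval_add_average_brownian {Ω : Type*} [MeasurableSpace Ω] {μ : Measure Ω}
    {V : ℝ≥0 → Ω → ℝ} (hV : IsPreBrownianReal V μ) (hVm : ∀ s, Measurable (V s))
    (hVc : ∀ ω, Continuous fun s => V s ω) {S T : ℝ} (hT : 0 ≤ T) (hTS : T ≤ S) (u b : ℝ) :
    ∫ ω, Complex.exp (((u * V S.toNNReal ω + b * ∫ s in (0 : ℝ)..1, V (s * T).toNNReal ω : ℝ) : ℂ)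
        * Complex.I) ∂μ =
      Complex.exp (-((u ^ 2 * S + u * b * T + b ^ 2 * (T / 3) : ℝ) : ℂ) / 2) := by
  have hprob := hV.isGaussianProcess.isProbabilityMeasure
  let t : (n : ℕ) → Option (Fin (n + 1)) → ℝ≥0 := fun n o =>
    o.elim S.toNNReal fun k => ((k : ℝ) / (n + 1) * T).toNNReal
  let c : (n : ℕ) → Option (Fin (n + 1)) → ℝ := fun n o => o.elim u fun _ => b * (1 / (n + 1))
  have hsum : ∀ (n : ℕ) (ω : Ω), ∑ i, c n i * V (t n i) ω = u * V S.toNNReal ω +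
      b * ∑ k ∈ Finset.range (n + 1),
        (1 / ((n : ℝ) + 1)) * V ((k : ℝ) / (n + 1) * T).toNNReal ω := by
    intro n ω
    rw [Fintype.sum_option, Finset.sum_range, Finset.mul_sum]
    simp [c, t, mul_assoc]
  have hvar : ∀ n : ℕ, ∑ i, ∑ j, c n i * c n j * (min (t n i) (t n j) : ℝ≥0) =
      u ^ 2 * S + u * b * T * (1 - 1 / ((n : ℝ) + 1)) +
        b ^ 2 * T * (1 - 1 / ((n : ℝ) + 1)) * (2 - 1 / ((n : ℝ) + 1)) / 6 := by
    intro n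
    have hn : (0 : ℝ) < n + 1 := by positivity
    have hk1 : ∀ k : Fin (n + 1), (k : ℝ) / (n + 1) * T ≤ S := fun k => by
      have : (k : ℝ) / (n + 1) ≤ 1 := by
        rw [div_le_one hn]
        exact_mod_cast k.2.le
      nlinarith
    have hk0 : ∀ k : Fin (n + 1), 0 ≤ (k : ℝ) / (n + 1) * T := fun k => by positivity
    have hkl : ∀ k l : Fin (n + 1), min ((k : ℝ) / (n + 1) * T) ((l : ℝ) / (n + 1) * T) =
        min (k : ℝ) l * (T / (n + 1)) := fun k l => by
      rw [min_mul_of_nonneg _ _ (by positivity : 0 ≤ T / ((n : ℝ) + 1))]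
      congr 1 <;> ring
    simp only [Fintype.sum_option, c, t, Option.elim_none, Option.elim_some, NNReal.coe_min,
      min_self, Real.coe_toNNReal _ (hT.trans hTS), Real.coe_toNNReal _ (hk0 _),
      min_eq_left (hk1 _), min_eq_right (hk1 _), hkl, Finset.sum_add_distrib, ← Finset.mul_sum,
      ← Finset.sum_mul, ← Finset.sum_div]
    have hs1 : ∑ k : Fin (n + 1), (k : ℝ) = (n + 1) * n / 2 := by
      rw [Fin.sum_univ_eq_sum_range (fun k : ℕ => (k : ℝ))]
      have := Finset.sum_range_id_mul_two (n + 1)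
      have h2 : ((∑ k ∈ Finset.range (n + 1), k : ℕ) : ℝ) * 2 = (n + 1) * n := by
        exact_mod_cast this
      push_cast at h2
      linarith
    have hs2 : ∑ k : Fin (n + 1), ∑ l : Fin (n + 1), min (k : ℝ) l =
        (n + 1) * n * (2 * n + 1) / 6 := by
      have h := sum_range_sum_range_min (n + 1)
      simp only [Finset.sum_range] at h
      rw [h]
      push_cast
      ring
    rw [hs1, hs2]
    field_simp
    ring
  have hlim : Filter.Tendsto (fun n : ℕ => ∫ ω,
      Complex.exp (((∑ i, c n i * V (t n i) ω : ℝ) : ℂ) * Complex.I) ∂μ) Filter.atTop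
      (𝓝 (∫ ω, Complex.exp (((u * V S.toNNReal ω +
        b * ∫ s in (0 : ℝ)..1, V (s * T).toNNReal ω : ℝ) : ℂ) * Complex.I) ∂μ)) := by
    refine tendsto_integral_of_dominated_convergence (fun _ => 1) (fun n => ?_)
      (integrable_const _) (fun n => ae_of_all _ fun ω => ?_) (ae_of_all _ fun ω => ?_)
    · refine Measurable.aestronglyMeasurable ?_
      fun_prop
    · rw [Complex.norm_exp_ofReal_mul_I]
    · simp only [hsum]
      have hc : Continuous fun s : ℝ => V (s * T).toNNReal ω :=
        (hVc ω).comp (continuous_real_toNNReal.comp (by fun_prop))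
      have h := ((tendsto_riemannSum hc).const_mul b).const_add (u * V S.toNNReal ω)
      exact (Continuous.tendsto (by fun_prop : Continuous fun x : ℝ =>
        Complex.exp ((x : ℂ) * Complex.I)) _).comp h
  refine tendsto_nhds_unique hlim ?_
  simp_rw [integral_exp_linearCombination_brownian hV, hvar]
  have h0 := tendsto_one_div_add_atTop_nhds_zero_nat (𝕜 := ℝ)
  have hcont : Continuous fun r : ℝ => Complex.exp (-((u ^ 2 * S + u * b * T * (1 - r) +
      b ^ 2 * T * (1 - r) * (2 - r) / 6 : ℝ) : ℂ) / 2) := by fun_prop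
  convert (hcont.tendsto 0).comp h0 using 2
  norm_num
  ring_nf

/-! ### Fisher information does not depend on the choice of the likelihood -/

/-- Two likelihoods agree almost everywhere for countably many parameters that are dense in `Θ`,
hence, by continuity in the parameter, almost every sample point has the same likelihood function
under both; so the scores agree almost everywhere. -/
lemma IsLikelihood.score_ae_eq {K : ℕ} {𝓧 : Type*} [MeasurableSpace 𝓧] {ν : Measure 𝓧}
    [SigmaFinite ν] {P : EuclideanSpace ℝ (Fin K) → Measure 𝓧}
    {Θ : Set (EuclideanSpace ℝ (Fin K))} (hΘ : IsOpen Θ)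
    {p q : EuclideanSpace ℝ (Fin K) → 𝓧 → ℝ} (hp : IsLikelihood ν P Θ p)
    (hq : IsLikelihood ν P Θ q) {θ : EuclideanSpace ℝ (Fin K)} (hθ : θ ∈ Θ) :
    ∀ᵐ x ∂ν, ∀ i, score p θ i x = score q θ i x := by
  obtain ⟨D, hDΘ, hDc, hD⟩ :=
    (TopologicalSpace.IsSeparable.of_separableSpace Θ).exists_countable_dense_subset
  have hae : ∀ᵐ x ∂ν, ∀ θ' ∈ D, p θ' x = q θ' x := by
    rw [ae_ball_iff hDc]
    intro θ' hθ'
    have hmp := (hp.measurable θ' (hDΘ hθ')).ennreal_ofReal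
    have hmq := (hq.measurable θ' (hDΘ hθ')).ennreal_ofReal
    have h := (hp.density θ' (hDΘ hθ')).symm.trans (hq.density θ' (hDΘ hθ'))
    rw [withDensity_eq_iff_of_sigmaFinite hmp.aemeasurable hmq.aemeasurable] at h
    filter_upwards [h] with x hx
    exact (ENNReal.ofReal_eq_ofReal_iff (hp.nonneg θ' (hDΘ hθ') x)
      (hq.nonneg θ' (hDΘ hθ') x)).1 hx
  filter_upwards [hae, hp.contDiff, hq.contDiff] with x hx hpx hqx i
  have heq : Set.EqOn (fun θ' => p θ' x) (fun θ' => q θ' x) Θ :=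
    Set.EqOn.of_subset_closure (fun θ' hθ' => hx θ' hθ') hpx.continuousOn hqx.continuousOn hDΘ hD
  have hev : (fun θ' => Real.log (p θ' x)) =ᶠ[𝓝 θ] fun θ' => Real.log (q θ' x) := by
    filter_upwards [hΘ.mem_nhds hθ] with θ' hθ'
    rw [show p θ' x = q θ' x from heq hθ']
  rw [score, score, hev.fderiv_eq]

lemma IsLikelihood.hasFisherInformation {K : ℕ} {𝓧 : Type*} [MeasurableSpace 𝓧] {ν : Measure 𝓧}
    [SigmaFinite ν] {P : EuclideanSpace ℝ (Fin K) → Measure 𝓧}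
    {Θ : Set (EuclideanSpace ℝ (Fin K))} (hΘ : IsOpen Θ)
    {p : EuclideanSpace ℝ (Fin K) → 𝓧 → ℝ} (hp : IsLikelihood ν P Θ p)
    {θ : EuclideanSpace ℝ (Fin K)} (hθ : θ ∈ Θ) {I : Matrix (Fin K) (Fin K) ℝ}
    (h : ∀ i j, Integrable (fun x => score p θ i x * score p θ j x) (P θ) ∧
      I i j = ∫ x, score p θ i x * score p θ j x ∂(P θ)) :
    HasFisherInformation ν P Θ θ I := by
  refine ⟨⟨p, hp⟩, fun q hq i j => ?_⟩
  have hac : P θ ≪ ν := by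
    rw [hp.density θ hθ]
    exact withDensity_absolutelyContinuous _ _
  have hpq : (fun x => score p θ i x * score p θ j x) =ᵐ[P θ]
      fun x => score q θ i x * score q θ j x := by
    filter_upwards [hac.ae_le (hp.score_ae_eq hΘ hq hθ)] with x hx
    rw [hx i, hx j]
  exact ⟨(h i j).1.congr hpq, (h i j).2.trans (integral_congr_ae hpq)⟩

/-! ### Derivatives of the impact functions in the parameter -/

/-- The partial derivative `∂f(v; θ)/∂θ_i` of an impact function. -/
noncomputable def impactDeriv {K : ℕ} (f : EuclideanSpace ℝ (Fin K) → ℝ → ℝ)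
    (θ : EuclideanSpace ℝ (Fin K)) (i : Fin K) (v : ℝ) : ℝ :=
  fderiv ℝ (fun θ' => f θ' v) θ (EuclideanSpace.single i 1)

lemma aemeasurable_impactDeriv {K : ℕ} {Θ : Set (EuclideanSpace ℝ (Fin K))} (hΘ : IsOpen Θ)
    {f : EuclideanSpace ℝ (Fin K) → ℝ → ℝ} {G : Measure (ℝ × ℝ)}
    (hf : ∀ θ ∈ Θ, Measurable (f θ)) (hd : ∀ᵐ a ∂G, ContDiffOn ℝ 1 (fun θ => f θ a.1) Θ)
    {θ : EuclideanSpace ℝ (Fin K)} (hθ : θ ∈ Θ) (i : Fin K) :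
    AEMeasurable (fun a : ℝ × ℝ => impactDeriv f θ i a.1) G := by
  classical
  let e : EuclideanSpace ℝ (Fin K) := EuclideanSpace.single i 1
  have h0 := tendsto_one_div_add_atTop_nhds_zero_nat (𝕜 := ℝ)
  have hd0 : Filter.Tendsto (fun n : ℕ => θ + (1 / ((n : ℝ) + 1)) • e) Filter.atTop (𝓝 θ) := by
    simpa using (h0.smul_const e).const_add θ
  have hmem : ∀ᶠ n : ℕ in Filter.atTop, θ + (1 / ((n : ℝ) + 1)) • e ∈ Θ :=
    hd0.eventually (hΘ.mem_nhds hθ)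
  -- difference quotients along `e`, set to zero where the shifted parameter leaves `Θ`
  refine aemeasurable_of_tendsto_metrizable_ae Filter.atTop (f := fun (n : ℕ) (a : ℝ × ℝ) =>
    if θ + (1 / ((n : ℝ) + 1)) • e ∈ Θ then
      ((n : ℝ) + 1) * (f (θ + (1 / ((n : ℝ) + 1)) • e) a.1 - f θ a.1) else 0) (fun n => ?_) ?_
  · split_ifs with h
    · exact ((((hf _ h).comp measurable_fst).sub ((hf _ hθ).comp measurable_fst)).const_mul
        _).aemeasurable
    · exact aemeasurable_const
  · filter_upwards [hd] with a ha
    have hda : HasFDerivAt (fun θ' => f θ' a.1) (fderiv ℝ (fun θ' => f θ' a.1) θ) θ :=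
      ((ha.differentiableOn one_ne_zero).differentiableAt (hΘ.mem_nhds hθ)).hasFDerivAt
    have hlim := hda.lim e (c := fun n : ℕ => (n : ℝ) + 1) (l := Filter.atTop) (by
      refine Filter.tendsto_atTop_mono (fun n => Real.le_norm_self _) ?_
      exact Filter.tendsto_atTop_add_const_right _ _ tendsto_natCast_atTop_atTop)
    refine hlim.congr' ?_
    filter_upwards [hmem] with n hn
    rw [if_pos hn, smul_eq_mul, one_div]

lemma exists_bound_impactDeriv {K : ℕ} {Θ : Set (EuclideanSpace ℝ (Fin K))}
    {g h : EuclideanSpace ℝ (Fin K) → ℝ → ℝ} {G : Measure (ℝ × ℝ)} (hreg : RegularModel Θ g h G)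
    {θ : EuclideanSpace ℝ (Fin K)} (hθ : θ ∈ Θ) :
    ∃ L : ℝ, 0 ≤ L ∧ ∀ᵐ a ∂G, ∀ i, |impactDeriv g θ i a.1| ≤ L ∧ |impactDeriv h θ i a.1| ≤ L := by
  obtain ⟨U, hU, L, hL⟩ := hreg.lipschitz θ hθ
  refine ⟨max L 0, le_max_right _ _, ?_⟩
  filter_upwards [hL] with a ha i
  have key : ∀ f : EuclideanSpace ℝ (Fin K) → ℝ → ℝ,
      (∀ θ₁ ∈ U, |f θ₁ a.1 - f θ a.1| ≤ L * ‖θ₁ - θ‖) → |impactDeriv f θ i a.1| ≤ max L 0 := by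
    intro f hf
    have hb : ‖fderiv ℝ (fun θ' => f θ' a.1) θ‖ ≤ max L 0 := by
      refine norm_fderiv_le_of_lip' ℝ (le_max_right _ _) ?_
      filter_upwards [hU] with θ' hθ'
      exact (hf θ' hθ').trans (by gcongr; exact le_max_left _ _)
    have := (fderiv ℝ (fun θ' => f θ' a.1) θ).le_of_opNorm_le hb (EuclideanSpace.single i 1)
    simpa [impactDeriv] using this
  exact ⟨key g fun θ₁ h₁ => (ha θ₁ h₁ θ (mem_of_mem_nhds hU)).1,
    key h fun θ₁ h₁ => (ha θ₁ h₁ θ (mem_of_mem_nhds hU)).2⟩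

/-! ### Statistics that are linear in the impact functions with Gaussian noise -/

/-- After the unimodular change of coordinates `B`, the coordinates of the statistic `stat` of an
order `(v, T)` are `α k T * g v + β k T * h v` plus independent centered Gaussian noises
`N ((v, T), ·) k` of variances `c k T`. Nothing is asked of nonpositive durations. -/
structure IsGaussianRegression {Ω : Type*} [MeasurableSpace Ω] (μ : Measure Ω) (V : ℝ≥0 → Ω → ℝ)
    {n : ℕ} (stat : (ℝ → ℝ) → (ℝ → ℝ) → (ℝ≥0 → ℝ) → ℝ → ℝ → Fin n → ℝ)
    (B : Matrix (Fin n) (Fin n) ℝ) (α β c : Fin n → ℝ → ℝ)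
    (N : (ℝ × ℝ) × Ω → Fin n → ℝ) : Prop where
  det_eq_one : B.det = 1
  continuous_α : ∀ k, Continuous (α k)
  continuous_β : ∀ k, Continuous (β k)
  continuous_c : ∀ k, Continuous (c k)
  c_pos : ∀ k T, 0 < T → 0 < c k T
  measurable_noise : Measurable N
  map_noise : ∀ a : ℝ × ℝ, 0 < a.2 →
    μ.map (fun ω => N (a, ω)) = Measure.pi fun k => gaussianReal 0 (c k a.2).toNNReal
  mulVec_stat : ∀ (g h : ℝ → ℝ) (a : ℝ × ℝ) (ω : Ω), 0 < a.2 →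
    B.mulVec (stat g h (fun s => V s ω) a.1 a.2) =
      (fun k => α k a.2 * g a.1 + β k a.2 * h a.1) + N (a, ω)

/-- The density of a Gaussian regression with respect to `G ⊗ volume`. -/
noncomputable def regressionDensity {n : ℕ} (B : Matrix (Fin n) (Fin n) ℝ)
    (α β c : Fin n → ℝ → ℝ) (g h : ℝ → ℝ) (z : (ℝ × ℝ) × (Fin n → ℝ)) : ℝ :=
  ∏ k, gaussianPDFReal (α k z.1.2 * g z.1.1 + β k z.1.2 * h z.1.1) (c k z.1.2).toNNReal
    (B.mulVec z.2 k)

/-- The density of `B⁻¹ (m + N)` for a Gaussian vector `N` with independent coordinates; no Jacobian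
appears because `B` is unimodular. -/
lemma map_affine_gaussian {Ω : Type*} [MeasurableSpace Ω] {μ : Measure Ω} {n : ℕ}
    {B : Matrix (Fin n) (Fin n) ℝ} (hB : B.det = 1) (m : Fin n → ℝ) {c : Fin n → ℝ≥0}
    (hc : ∀ k, c k ≠ 0) {N : Ω → Fin n → ℝ} (hN : Measurable N)
    (hlaw : μ.map N = Measure.pi fun k => gaussianReal 0 (c k)) :
    μ.map (fun ω => B⁻¹.mulVec (m + N ω)) =
      volume.withDensity fun x => ENNReal.ofReal
        (∏ k, gaussianPDFReal (m k) (c k) (B.mulVec x k)) := by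
  have hBc : Measurable fun x : Fin n → ℝ => B.mulVec x := by fun_prop
  have hBi : Measurable fun x : Fin n → ℝ => B⁻¹.mulVec x := by fun_prop
  have hpres : MeasurePreserving (fun x : Fin n → ℝ => B.mulVec x) volume volume := by
    refine ⟨hBc, ?_⟩
    have h := Real.map_matrix_volume_pi_eq_smul_volume_pi (M := B) (by rw [hB]; exact one_ne_zero)
    rw [hB] at h
    rw [inv_one, abs_one, ENNReal.ofReal_one, one_smul] at h
    exact h
  have hshift : μ.map (fun ω => m + N ω) = Measure.pi fun k => gaussianReal (m k) (c k) := by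
    rw [show (fun ω => m + N ω) = (fun y => m + y) ∘ N from rfl,
      ← Measure.map_map (by fun_prop) hN, hlaw]
    have h := Measure.pi_map_pi (μ := fun k => gaussianReal 0 (c k)) (f := fun k x => m k + x)
      (fun k => by fun_prop)
    simp_rw [gaussianReal_map_const_add, zero_add] at h
    exact h
  rw [show (fun ω => B⁻¹.mulVec (m + N ω)) = (fun y => B⁻¹.mulVec y) ∘ fun ω => m + N ω from rfl,
    ← Measure.map_map hBi (by fun_prop), hshift, pi_gaussianReal_eq_withDensity m c hc]
  ext s hs
  rw [Measure.map_apply hBi hs, withDensity_apply _ (hBi hs), withDensity_apply _ hs]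
  have hpre : (fun x : Fin n → ℝ => B.mulVec x) ⁻¹' ((fun y => B⁻¹.mulVec y) ⁻¹' s) = s := by
    ext x
    simp [Matrix.mulVec_mulVec, Matrix.nonsing_inv_mul B (by rw [hB]; exact isUnit_one)]
  rw [← hpres.setLIntegral_comp_preimage (hBi hs) (by fun_prop), hpre]

section Regression

variable {Ω : Type*} [MeasurableSpace Ω] {μ : Measure Ω}
  {V : ℝ≥0 → Ω → ℝ} {n : ℕ} {stat : (ℝ → ℝ) → (ℝ → ℝ) → (ℝ≥0 → ℝ) → ℝ → ℝ → Fin n → ℝ}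
  {B : Matrix (Fin n) (Fin n) ℝ} {α β c : Fin n → ℝ → ℝ} {N : (ℝ × ℝ) × Ω → Fin n → ℝ}

lemma IsGaussianRegression.measurable_regressionDensity
    (hS : IsGaussianRegression μ V stat B α β c N) {g h : ℝ → ℝ} (hg : Measurable g)
    (hh : Measurable h) : Measurable (regressionDensity B α β c g h) := by
  have hα := fun k => (hS.continuous_α k).measurable
  have hβ := fun k => (hS.continuous_β k).measurable
  have hc := fun k => (hS.continuous_c k).measurable
  unfold regressionDensity gaussianPDFReal
  fun_prop

/-- The sample as an explicit measurable function of `(v, T)` and the noise. -/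
lemma IsGaussianRegression.sampleLaw_eq_map
    (hS : IsGaussianRegression μ V stat B α β c N) {G : Measure (ℝ × ℝ)} [IsProbabilityMeasure G]
    (hG : ∀ᵐ a ∂G, 0 < a.2) (g h : ℝ → ℝ) :
    sampleLaw μ V G (stat g h) = (G.prod μ).map fun z =>
      (z.1, B⁻¹.mulVec ((fun k => α k z.1.2 * g z.1.1 + β k z.1.2 * h z.1.1) + N z)) := by
  refine Measure.map_congr ?_
  filter_upwards [Measure.quasiMeasurePreserving_fst.ae hG] with z hz
  rw [← hS.mulVec_stat g h z.1 z.2 hz, Matrix.mulVec_mulVec,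
    Matrix.nonsing_inv_mul B (by rw [hS.det_eq_one]; exact isUnit_one), Matrix.one_mulVec]

lemma IsGaussianRegression.measurable_sample
    (hS : IsGaussianRegression μ V stat B α β c N) {g h : ℝ → ℝ} (hg : Measurable g)
    (hh : Measurable h) : Measurable fun z : (ℝ × ℝ) × Ω =>
      (z.1, B⁻¹.mulVec ((fun k => α k z.1.2 * g z.1.1 + β k z.1.2 * h z.1.1) + N z)) := by
  have hα := fun k => (hS.continuous_α k).measurable
  have hβ := fun k => (hS.continuous_β k).measurable
  have hN := hS.measurable_noise
  refine measurable_fst.prodMk ((by fun_prop : Measurable fun x : Fin n → ℝ =>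
    B⁻¹.mulVec x).comp ?_)
  fun_prop

lemma IsGaussianRegression.sampleLaw_eq_withDensity [IsProbabilityMeasure μ]
    (hS : IsGaussianRegression μ V stat B α β c N) {G : Measure (ℝ × ℝ)} [IsProbabilityMeasure G]
    (hG : ∀ᵐ a ∂G, 0 < a.2) {g h : ℝ → ℝ} (hg : Measurable g) (hh : Measurable h) :
    sampleLaw μ V G (stat g h) =
      (G.prod volume).withDensity fun z => ENNReal.ofReal (regressionDensity B α β c g h z) := by
  have hX := hS.measurable_sample hg hh
  have hq := (hS.measurable_regressionDensity hg hh).ennreal_ofReal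
  rw [hS.sampleLaw_eq_map hG]
  ext s hs
  rw [Measure.map_apply hX hs, Measure.prod_apply (hX hs), withDensity_apply _ hs,
    ← lintegral_indicator hs, lintegral_prod _ (hq.indicator hs).aemeasurable]
  refine lintegral_congr_ae ?_
  filter_upwards [hG] with a ha
  have hlaw := map_affine_gaussian hS.det_eq_one (fun k => α k a.2 * g a.1 + β k a.2 * h a.1)
    (c := fun k => (c k a.2).toNNReal) (fun k => (Real.toNNReal_pos.2 (hS.c_pos k a.2 ha)).ne')
    (hS.measurable_noise.comp measurable_prodMk_left) (hS.map_noise a ha)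
  have hsa : MeasurableSet (Prod.mk a ⁻¹' s) := measurable_prodMk_left hs
  have h1 := congrArg (fun ρ => ρ (Prod.mk a ⁻¹' s)) hlaw
  rw [Measure.map_apply ?_ hsa, withDensity_apply _ hsa, ← lintegral_indicator hsa] at h1
  · exact h1
  · exact measurable_snd.comp (hX.comp measurable_prodMk_left)

variable {K : ℕ} {Θ : Set (EuclideanSpace ℝ (Fin K))} {g h : EuclideanSpace ℝ (Fin K) → ℝ → ℝ}
  {G : Measure (ℝ × ℝ)}

lemma RegularModel.ae_duration_pos (hreg : RegularModel Θ g h G) : ∀ᵐ a ∂G, 0 < a.2 := by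
  obtain ⟨T_L, T_U, hT_L, hT⟩ := hreg.duration_bounds
  filter_upwards [hT] with a ha using hT_L.trans_le ha.1

lemma IsGaussianRegression.isLikelihood [IsProbabilityMeasure μ] [IsProbabilityMeasure G]
    (hS : IsGaussianRegression μ V stat B α β c N) (hreg : RegularModel Θ g h G) :
    IsLikelihood (G.prod volume) (fun θ => sampleLaw μ V G (stat (g θ) (h θ))) Θ
      fun θ => regressionDensity B α β c (g θ) (h θ) where
  measurable θ hθ :=
    hS.measurable_regressionDensity (hreg.measurable_g θ hθ) (hreg.measurable_h θ hθ)
  nonneg θ _ z := Finset.prod_nonneg fun k _ => gaussianPDFReal_nonneg _ _ _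
  density θ hθ := hS.sampleLaw_eq_withDensity hreg.ae_duration_pos (hreg.measurable_g θ hθ)
    (hreg.measurable_h θ hθ)
  contDiff := by
    filter_upwards [Measure.quasiMeasurePreserving_fst.ae hreg.contDiff_g,
      Measure.quasiMeasurePreserving_fst.ae hreg.contDiff_h] with z hg hh
    unfold regressionDensity gaussianPDFReal
    refine contDiffOn_prod fun k _ => contDiffOn_const.mul (ContDiffOn.exp ?_)
    exact (((contDiffOn_const.sub ((contDiffOn_const.mul hg).add
      (contDiffOn_const.mul hh))).pow 2).neg).div_const _

/-- The coefficient of the `k`-th noise in the `i`-th score of a Gaussian regression. -/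
noncomputable def scoreCoeff (α β c : Fin n → ℝ → ℝ)
    (g h : EuclideanSpace ℝ (Fin K) → ℝ → ℝ) (θ : EuclideanSpace ℝ (Fin K)) (i : Fin K)
    (k : Fin n) (a : ℝ × ℝ) : ℝ :=
  α k a.2 / c k a.2 * impactDeriv g θ i a.1 + β k a.2 / c k a.2 * impactDeriv h θ i a.1

/-- The score of a Gaussian regression: weighted residuals times derivatives of the means. -/
lemma IsGaussianRegression.score_eq (hS : IsGaussianRegression μ V stat B α β c N)
    {θ : EuclideanSpace ℝ (Fin K)} {a : ℝ × ℝ} (ha : 0 < a.2)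
    (hg : DifferentiableAt ℝ (fun θ' => g θ' a.1) θ)
    (hh : DifferentiableAt ℝ (fun θ' => h θ' a.1) θ) (x : Fin n → ℝ) (i : Fin K) :
    score (fun θ => regressionDensity B α β c (g θ) (h θ)) θ i (a, x) =
      ∑ k, scoreCoeff α β c g h θ i k a *
          (B.mulVec x k - (α k a.2 * g θ a.1 + β k a.2 * h θ a.1)) := by
  have hc : ∀ k, 0 < c k a.2 := fun k => hS.c_pos k a.2 ha
  have hlog : (fun θ' => Real.log (regressionDensity B α β c (g θ') (h θ') (a, x))) =
      fun θ' => ∑ k, (Real.log (√(2 * Real.pi * c k a.2))⁻¹ +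
        -(B.mulVec x k - (α k a.2 * g θ' a.1 + β k a.2 * h θ' a.1)) ^ 2 / (2 * c k a.2)) := by
    funext θ'
    rw [regressionDensity, Real.log_prod fun k _ => (gaussianPDFReal_pos _ _ _
      (Real.toNNReal_pos.2 (hc k)).ne').ne']
    refine Finset.sum_congr rfl fun k _ => ?_
    have hk := hc k
    rw [gaussianPDFReal, Real.log_mul (by
      rw [Real.coe_toNNReal _ hk.le]; positivity) (Real.exp_ne_zero _), Real.log_exp,
      Real.coe_toNNReal _ hk.le]
  have hterm : ∀ k, HasFDerivAt (fun θ' => Real.log (√(2 * Real.pi * c k a.2))⁻¹ +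
        -(B.mulVec x k - (α k a.2 * g θ' a.1 + β k a.2 * h θ' a.1)) ^ 2 / (2 * c k a.2))
      (((B.mulVec x k - (α k a.2 * g θ a.1 + β k a.2 * h θ a.1)) / c k a.2) •
        (α k a.2 • fderiv ℝ (fun θ' => g θ' a.1) θ + β k a.2 • fderiv ℝ (fun θ' => h θ' a.1) θ))
      θ := by
    intro k
    have h1 := (hg.hasFDerivAt.const_mul (α k a.2)).add (hh.hasFDerivAt.const_mul (β k a.2))
    have h2 := ((((h1.const_sub (B.mulVec x k)).pow 2).neg).mul_const
      (2 * c k a.2)⁻¹).const_add (Real.log (√(2 * Real.pi * c k a.2))⁻¹)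
    refine (h2.congr_fderiv ?_)
    ext y
    have := (hc k).ne'
    simp
    field_simp
  rw [score, hlog, (HasFDerivAt.fun_sum fun k _ => hterm k).fderiv]
  simp only [FunLike.coe_sum, Finset.sum_apply]
  refine Finset.sum_congr rfl fun k _ => ?_
  simp [scoreCoeff, impactDeriv]
  ring

/-- The integrand of the Fisher information of a Gaussian regression. -/
noncomputable def fisherIntegrand (α β c : Fin n → ℝ → ℝ)
    (g h : EuclideanSpace ℝ (Fin K) → ℝ → ℝ) (θ : EuclideanSpace ℝ (Fin K)) (i j : Fin K)
    (a : ℝ × ℝ) : ℝ :=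
  ∑ k, (α k a.2 * impactDeriv g θ i a.1 + β k a.2 * impactDeriv h θ i a.1) *
    (α k a.2 * impactDeriv g θ j a.1 + β k a.2 * impactDeriv h θ j a.1) / c k a.2

/-- The Fisher information matrix of a Gaussian regression. -/
noncomputable def regressionFisher (α β c : Fin n → ℝ → ℝ)
    (g h : EuclideanSpace ℝ (Fin K) → ℝ → ℝ) (G : Measure (ℝ × ℝ))
    (θ : EuclideanSpace ℝ (Fin K)) : Matrix (Fin K) (Fin K) ℝ :=
  Matrix.of fun i j => ∫ a, fisherIntegrand α β c g h θ i j a ∂G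

/-- The coefficients of the score in the noise are measurable and bounded in `(v, T)`: durations
stay in a compact interval of positive numbers and the impact functions are Lipschitz. -/
lemma IsGaussianRegression.scoreCoeff_bound (hS : IsGaussianRegression μ V stat B α β c N)
    (hreg : RegularModel Θ g h G) {θ : EuclideanSpace ℝ (Fin K)} (hθ : θ ∈ Θ) (k : Fin n)
    (i : Fin K) :
    AEMeasurable (scoreCoeff α β c g h θ i k) G ∧
      ∃ C, ∀ᵐ a ∂G, ‖scoreCoeff α β c g h θ i k a‖ ≤ C := by
  have hα := (hS.continuous_α k).measurable
  have hβ := (hS.continuous_β k).measurable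
  have hc := (hS.continuous_c k).measurable
  have hmg := aemeasurable_impactDeriv hreg.isOpen hreg.measurable_g hreg.contDiff_g hθ i
  have hmh := aemeasurable_impactDeriv hreg.isOpen hreg.measurable_h hreg.contDiff_h hθ i
  refine ⟨by unfold scoreCoeff; fun_prop, ?_⟩
  obtain ⟨T_L, T_U, hT_L, hT⟩ := hreg.duration_bounds
  obtain ⟨L, hL0, hL⟩ := exists_bound_impactDeriv hreg hθ
  have hne : ∀ T ∈ Set.Icc T_L T_U, c k T ≠ 0 := fun T hT =>
    (hS.c_pos k T (hT_L.trans_le hT.1)).ne'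
  obtain ⟨A, hA⟩ := (isCompact_Icc (a := T_L) (b := T_U)).exists_bound_of_continuousOn
    ((hS.continuous_α k).continuousOn.div (hS.continuous_c k).continuousOn hne)
  obtain ⟨A', hA'⟩ := (isCompact_Icc (a := T_L) (b := T_U)).exists_bound_of_continuousOn
    ((hS.continuous_β k).continuousOn.div (hS.continuous_c k).continuousOn hne)
  refine ⟨A * L + A' * L, ?_⟩
  filter_upwards [hT, hL] with a ha hLa
  refine (norm_add_le _ _).trans (add_le_add ?_ ?_) <;> rw [norm_mul]
  · exact mul_le_mul (hA a.2 ha) (hLa i).1 (norm_nonneg _) ((norm_nonneg _).trans (hA a.2 ha))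
  · exact mul_le_mul (hA' a.2 ha) (hLa i).2 (norm_nonneg _) ((norm_nonneg _).trans (hA' a.2 ha))

lemma IsGaussianRegression.map_noise_apply (hS : IsGaussianRegression μ V stat B α β c N)
    {a : ℝ × ℝ} (ha : 0 < a.2) (k : Fin n) :
    μ.map (fun ω => N (a, ω) k) = gaussianReal 0 (c k a.2).toNNReal := by
  have hNa : Measurable fun ω => N (a, ω) := hS.measurable_noise.comp measurable_prodMk_left
  have := Measure.map_map (measurable_pi_apply k) hNa (μ := μ)
  rw [hS.map_noise a ha, (measurePreserving_eval _ k).map_eq] at this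
  exact this.symm

lemma IsGaussianRegression.memLp_noise_apply (hS : IsGaussianRegression μ V stat B α β c N)
    {a : ℝ × ℝ} (ha : 0 < a.2) (k : Fin n) : MemLp (fun ω => N (a, ω) k) 2 μ := by
  have hNa : Measurable fun ω => N (a, ω) k :=
    (measurable_pi_apply k).comp (hS.measurable_noise.comp measurable_prodMk_left)
  have h := memLp_id_gaussianReal (μ := 0) (v := (c k a.2).toNNReal) 2
  rw [← hS.map_noise_apply ha k] at h
  exact (memLp_map_measure_iff (by fun_prop) hNa.aemeasurable).1 h

lemma IsGaussianRegression.integral_noise_mul [IsProbabilityMeasure μ]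
    (hS : IsGaussianRegression μ V stat B α β c N)
    {a : ℝ × ℝ} (ha : 0 < a.2) (k l : Fin n) :
    ∫ ω, N (a, ω) k * N (a, ω) l ∂μ = if k = l then c k a.2 else 0 := by
  have hNa : ∀ k, Measurable fun ω => N (a, ω) k := fun k =>
    (measurable_pi_apply k).comp (hS.measurable_noise.comp measurable_prodMk_left)
  have hmean : ∀ k, ∫ ω, N (a, ω) k ∂μ = 0 := fun k => by
    have h := integral_map (μ := μ) (hNa k).aemeasurable (f := fun x : ℝ => x) (by fun_prop)
    rw [← h, hS.map_noise_apply ha k, integral_id_gaussianReal]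
  split_ifs with hkl
  · subst hkl
    have h := variance_map (μ := μ) (X := id) (Y := fun ω => N (a, ω) k) (by fun_prop)
      (hNa k).aemeasurable
    rw [hS.map_noise_apply ha k, variance_id_gaussianReal, Function.id_comp,
      variance_of_integral_eq_zero (hNa k).aemeasurable (hmean k),
      Real.coe_toNNReal _ (hS.c_pos k _ ha).le] at h
    rw [h]
    simp_rw [sq]
  · have hind : iIndepFun (fun k ω => N (a, ω) k) μ := by
      rw [iIndepFun_iff_map_fun_eq_pi_map fun k => (hNa k).aemeasurable]
      simp_rw [hS.map_noise_apply ha]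
      exact hS.map_noise a ha
    have h := (hind.indepFun hkl).integral_fun_mul_eq_mul_integral
      (hNa k).aestronglyMeasurable (hNa l).aestronglyMeasurable
    rw [h, hmean, zero_mul]

lemma IsGaussianRegression.memLp_noise [IsProbabilityMeasure μ] [IsProbabilityMeasure G]
    (hS : IsGaussianRegression μ V stat B α β c N) (hreg : RegularModel Θ g h G) (k : Fin n) :
    MemLp (fun z => N z k) 2 (G.prod μ) := by
  have hN : Measurable fun z => N z k := (measurable_pi_apply k).comp hS.measurable_noise
  rw [memLp_two_iff_integrable_sq hN.aestronglyMeasurable,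
    integrable_prod_iff (hN.pow_const 2).aestronglyMeasurable]
  constructor
  · filter_upwards [hreg.ae_duration_pos] with a ha
    exact (hS.memLp_noise_apply ha k).integrable_sq
  · obtain ⟨T_L, T_U, hT_L, hT⟩ := hreg.duration_bounds
    obtain ⟨A, hA⟩ := (isCompact_Icc (a := T_L) (b := T_U)).exists_bound_of_continuousOn
      (hS.continuous_c k).continuousOn
    have hint : Integrable (fun a : ℝ × ℝ => c k a.2) G :=
      Integrable.of_bound ((hS.continuous_c k).measurable.comp measurable_snd).aestronglyMeasurable
        A (by filter_upwards [hT] with a ha using hA a.2 ha)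
    refine hint.congr ?_
    filter_upwards [hreg.ae_duration_pos] with a ha
    have := hS.integral_noise_mul ha k k
    simp only [Real.norm_eq_abs, abs_pow, sq_abs]
    simp_rw [sq, this, if_true]

/-- Products of two score components, as functions on the probability space, are integrable and
integrate to the Fisher information matrix. -/
lemma IsGaussianRegression.integrable_and_integral_score_mul [IsProbabilityMeasure μ]
    [IsProbabilityMeasure G] (hS : IsGaussianRegression μ V stat B α β c N)
    (hreg : RegularModel Θ g h G) {θ : EuclideanSpace ℝ (Fin K)} (hθ : θ ∈ Θ) (i j : Fin K) :
    Integrable (fun z => (∑ k, scoreCoeff α β c g h θ i k z.1 * N z k) *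
      ∑ k, scoreCoeff α β c g h θ j k z.1 * N z k) (G.prod μ) ∧
    Integrable (fisherIntegrand α β c g h θ i j) G ∧
    ∫ z, (∑ k, scoreCoeff α β c g h θ i k z.1 * N z k) *
      ∑ k, scoreCoeff α β c g h θ j k z.1 * N z k ∂(G.prod μ) =
      regressionFisher α β c g h G θ i j := by
  set u := scoreCoeff α β c g h θ with hu
  have hu2 : ∀ i, MemLp (fun z : (ℝ × ℝ) × Ω => ∑ k, u i k z.1 * N z k) 2 (G.prod μ) := by
    intro i
    refine memLp_finsetSum _ fun k _ => ?_
    obtain ⟨hm, C, hC⟩ := hS.scoreCoeff_bound hreg hθ k i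
    have hN := hS.memLp_noise hreg k
    refine hN.of_le_mul (c := C) ((hm.comp_quasiMeasurePreserving
      Measure.quasiMeasurePreserving_fst).aestronglyMeasurable.mul hN.aestronglyMeasurable) ?_
    filter_upwards [Measure.quasiMeasurePreserving_fst.ae hC] with z hz
    rw [norm_mul]
    exact mul_le_mul_of_nonneg_right hz (norm_nonneg _)
  have hint := (hu2 i).integrable_mul (hu2 j)
  have hinner : ∀ᵐ a ∂G, ∫ ω, (∑ k, u i k a * N (a, ω) k) * ∑ k, u j k a * N (a, ω) k ∂μ =
      fisherIntegrand α β c g h θ i j a := by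
    filter_upwards [hreg.ae_duration_pos] with a ha
    have hterm : ∀ k l, Integrable (fun ω => u i k a * N (a, ω) k * (u j l a * N (a, ω) l)) μ :=
      fun k l => ((hS.memLp_noise_apply ha k).const_mul _).integrable_mul
        ((hS.memLp_noise_apply ha l).const_mul _)
    simp_rw [Finset.sum_mul_sum]
    rw [integral_finsetSum _ fun k _ => integrable_finsetSum _ fun l _ => hterm k l]
    refine Finset.sum_congr rfl fun k _ => ?_
    rw [integral_finsetSum _ fun l _ => hterm k l]
    simp_rw [mul_mul_mul_comm (u i k a), integral_const_mul, hS.integral_noise_mul ha]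
    have := (hS.c_pos k a.2 ha).ne'
    simp only [mul_ite, mul_zero, Finset.sum_ite_eq, Finset.mem_univ, if_true, hu, scoreCoeff]
    field_simp
  refine ⟨hint, hint.integral_prod_left.congr hinner, ?_⟩
  exact (integral_prod _ hint).trans (integral_congr_ae hinner)

/-- The Fisher information of a Gaussian regression in a regular model. -/
theorem IsGaussianRegression.hasFisherInformation [IsProbabilityMeasure μ]
    [IsProbabilityMeasure G] (hS : IsGaussianRegression μ V stat B α β c N)
    (hreg : RegularModel Θ g h G) {θ : EuclideanSpace ℝ (Fin K)} (hθ : θ ∈ Θ) :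
    HasFisherInformation (G.prod volume) (fun θ' => sampleLaw μ V G (stat (g θ') (h θ'))) Θ θ
      (regressionFisher α β c g h G θ) := by
  have hlik := hS.isLikelihood hreg
  refine hlik.hasFisherInformation hreg.isOpen hθ fun i j => ?_
  set p := fun θ => regressionDensity B α β c (g θ) (h θ) with hp
  have hgood : ∀ᵐ a ∂G, 0 < a.2 ∧ DifferentiableAt ℝ (fun θ' => g θ' a.1) θ ∧
      DifferentiableAt ℝ (fun θ' => h θ' a.1) θ := by
    filter_upwards [hreg.ae_duration_pos, hreg.contDiff_g, hreg.contDiff_h] with a ha hga hha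
    exact ⟨ha, (hga.differentiableOn one_ne_zero).differentiableAt (hreg.isOpen.mem_nhds hθ),
      (hha.differentiableOn one_ne_zero).differentiableAt (hreg.isOpen.mem_nhds hθ)⟩
  have hac : sampleLaw μ V G (stat (g θ) (h θ)) ≪ G.prod volume := by
    rw [hlik.density θ hθ]
    exact withDensity_absolutelyContinuous _ _
  have hα := fun k => (hS.continuous_α k).measurable
  have hβ := fun k => (hS.continuous_β k).measurable
  have hgm := hreg.measurable_g θ hθ
  have hhm := hreg.measurable_h θ hθ
  have hmeas : ∀ i, AEMeasurable (score p θ i) (sampleLaw μ V G (stat (g θ) (h θ))) := by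
    intro i
    refine AEMeasurable.mono_ac ?_ hac
    have hsum : AEMeasurable (fun z : (ℝ × ℝ) × (Fin n → ℝ) =>
        ∑ k, scoreCoeff α β c g h θ i k z.1 *
          (B.mulVec z.2 k - (α k z.1.2 * g θ z.1.1 + β k z.1.2 * h θ z.1.1)))
        (G.prod volume) := by
      refine Finset.aemeasurable_fun_sum _ fun k _ => AEMeasurable.mul ?_ ?_
      · exact (hS.scoreCoeff_bound hreg hθ k i).1.comp_quasiMeasurePreserving
          Measure.quasiMeasurePreserving_fst
      · exact Measurable.aemeasurable (by fun_prop)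
    refine hsum.congr ?_
    filter_upwards [Measure.quasiMeasurePreserving_fst.ae hgood] with z hz
    exact (hS.score_eq hz.1 hz.2.1 hz.2.2 z.2 i).symm
  have hX := hS.measurable_sample hgm hhm
  have hscore : ∀ᵐ z ∂(G.prod μ), ∀ i, score p θ i (z.1, B⁻¹.mulVec
      ((fun k => α k z.1.2 * g θ z.1.1 + β k z.1.2 * h θ z.1.1) + N z)) =
      ∑ k, scoreCoeff α β c g h θ i k z.1 * N z k := by
    filter_upwards [Measure.quasiMeasurePreserving_fst.ae hgood] with z hz i
    rw [hp, hS.score_eq hz.1 hz.2.1 hz.2.2, Matrix.mulVec_mulVec,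
      Matrix.mul_nonsing_inv B (by rw [hS.det_eq_one]; exact isUnit_one), Matrix.one_mulVec]
    simp
  have hprod : AEStronglyMeasurable (fun x => score p θ i x * score p θ j x)
      (sampleLaw μ V G (stat (g θ) (h θ))) := ((hmeas i).mul (hmeas j)).aestronglyMeasurable
  obtain ⟨hint, -, hval⟩ := hS.integrable_and_integral_score_mul hreg hθ i j
  rw [hS.sampleLaw_eq_map hreg.ae_duration_pos] at hprod
  simp only [hS.sampleLaw_eq_map hreg.ae_duration_pos]
  rw [integrable_map_measure hprod hX.aemeasurable, integral_map hX.aemeasurable hprod, ← hval]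
  refine ⟨hint.congr ?_, integral_congr_ae ?_⟩
  all_goals
    filter_upwards [hscore] with z hz
    simp only [Function.comp_apply, hz]

end Regression

/-! ### The two experiments as Gaussian regressions -/

section Experiments

variable {Ω : Type*} [MeasurableSpace Ω] {μ : Measure Ω} {V : ℝ≥0 → Ω → ℝ}

lemma price_of_le {S₀ : ℝ} (hS₀ : S₀ ≠ 0) (σ : ℝ) (g h : ℝ → ℝ) (w : ℝ≥0 → ℝ) (v : ℝ) {T t : ℝ}
    (ht : t ≤ T) : price S₀ σ g h w v T t = g v * t + h v + σ * w t.toNNReal := by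
  rw [price, stockPrice, if_pos ht]
  field_simp
  ring

lemma price_of_lt {S₀ : ℝ} (hS₀ : S₀ ≠ 0) (σ : ℝ) (g h : ℝ → ℝ) (w : ℝ≥0 → ℝ) (v : ℝ) {T t : ℝ}
    (ht : T < t) : price S₀ σ g h w v T t = g v * T + σ * w t.toNNReal := by
  rw [price, stockPrice, if_neg ht.not_ge]
  field_simp
  ring

lemma realizedImpact_eq {S₀ : ℝ} (hS₀ : S₀ ≠ 0) (σ : ℝ) (g h : ℝ → ℝ) {w : ℝ≥0 → ℝ}
    (hw : Continuous w) (v : ℝ) {T : ℝ} (hT : 0 < T) :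
    realizedImpact S₀ σ g h w v T =
      T / 2 * g v + h v + σ * ∫ s in (0 : ℝ)..1, w (s * T).toNNReal := by
  have hc : Continuous fun t : ℝ => w t.toNNReal := hw.comp continuous_real_toNNReal
  have hcongr : ∫ t in (0 : ℝ)..T, price S₀ σ g h w v T t =
      ∫ t in (0 : ℝ)..T, (g v * t + h v + σ * w t.toNNReal) := by
    refine intervalIntegral.integral_congr fun t ht => ?_
    rw [Set.uIcc_of_le hT.le] at ht
    exact price_of_le hS₀ σ g h w v ht.2
  have hscale : ∫ s in (0 : ℝ)..1, w (s * T).toNNReal = T⁻¹ * ∫ t in (0 : ℝ)..T, w t.toNNReal := by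
    rw [intervalIntegral.integral_comp_mul_right (fun t => w t.toNNReal) hT.ne']
    simp
  rw [realizedImpact, hcongr, hscale, intervalIntegral.integral_add
    (Continuous.intervalIntegrable (by fun_prop) _ _)
    (Continuous.intervalIntegrable (by fun_prop) _ _), intervalIntegral.integral_add
    (Continuous.intervalIntegrable (by fun_prop) _ _)
    (Continuous.intervalIntegrable (by fun_prop) _ _), intervalIntegral.integral_const_mul,
    intervalIntegral.integral_const_mul, integral_id, intervalIntegral.integral_const]
  simp only [smul_eq_mul]
  field_simp
  ring

lemma measurable_process_comp (hVm : ∀ s, Measurable (V s)) (hVc : ∀ ω, Continuous fun s => V s ω)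
    {X : Type*} [MeasurableSpace X] {t : X → ℝ} (ht : Measurable t) {f : X → Ω}
    (hf : Measurable f) : Measurable fun x => V (t x).toNNReal (f x) :=
  (measurable_uncurry_of_continuous_of_measurable (u := fun s ω => V s ω) hVc hVm).comp
    (ht.real_toNNReal.prodMk hf)

/-- The three prices form a Gaussian regression, in the coordinates `P_t`, `P_T - P_t`,
`P_{T_post} - P_T`, whose noises are increments of the Brownian motion. -/
lemma isGaussianRegression_threePrices [IsProbabilityMeasure μ] (hV : IsPreBrownianReal V μ)
    (hVm : ∀ s, Measurable (V s)) (hVc : ∀ ω, Continuous fun s => V s ω)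
    {S₀ σ δ τ : ℝ} (hS₀ : 0 < S₀) (hσ : 0 < σ) (hδ : 0 < δ) (hτ0 : 0 < τ) (hτ1 : τ < 1) :
    IsGaussianRegression μ V (threePrices S₀ σ δ τ) !![1, 0, 0; -1, 1, 0; 0, -1, 1]
      ![fun T => τ * T, fun T => (1 - τ) * T, fun _ => 0] ![fun _ => 1, fun _ => 0, fun _ => -1]
      ![fun T => σ ^ 2 * (τ * T), fun T => σ ^ 2 * ((1 - τ) * T), fun _ => σ ^ 2 * δ]
      (fun z => ![σ * V (τ * z.1.2).toNNReal z.2,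
        σ * (V z.1.2.toNNReal z.2 - V (τ * z.1.2).toNNReal z.2),
        σ * (V (z.1.2 + δ).toNNReal z.2 - V z.1.2.toNNReal z.2)]) where
  det_eq_one := by simp [Matrix.det_fin_three]
  continuous_α k := by fin_cases k <;> simp <;> fun_prop
  continuous_β k := by fin_cases k <;> simp <;> fun_prop
  continuous_c k := by fin_cases k <;> simp <;> fun_prop
  c_pos k T hT := by
    have := sub_pos.2 hτ1
    fin_cases k <;> simp <;> positivity
  measurable_noise := by
    have h1 := measurable_process_comp hVm hVc (X := (ℝ × ℝ) × Ω) (t := fun z => τ * z.1.2)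
      (by fun_prop) measurable_snd
    have h2 := measurable_process_comp hVm hVc (X := (ℝ × ℝ) × Ω) (t := fun z => z.1.2)
      (by fun_prop) measurable_snd
    have h3 := measurable_process_comp hVm hVc (X := (ℝ × ℝ) × Ω) (t := fun z => z.1.2 + δ)
      (by fun_prop) measurable_snd
    rw [measurable_pi_iff]
    intro k
    fin_cases k
    exacts [h1.const_mul σ, (h2.sub h1).const_mul σ, (h3.sub h2).const_mul σ]
  map_noise a ha := by
    have hmeas : Measurable fun ω => (![σ * V (τ * a.2).toNNReal ω,
        σ * (V a.2.toNNReal ω - V (τ * a.2).toNNReal ω),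
        σ * (V (a.2 + δ).toNNReal ω - V a.2.toNNReal ω)] : Fin 3 → ℝ) := by
      rw [measurable_pi_iff]
      intro k
      fin_cases k <;> simp <;> fun_prop
    refine map_eq_pi_gaussianReal_of_charFun hmeas _ fun t => ?_
    have h := integral_exp_linearCombination_brownian hV
      ![(τ * a.2).toNNReal, a.2.toNNReal, (a.2 + δ).toNNReal]
      ![σ * (t 0 - t 1), σ * (t 1 - t 2), σ * t 2]
    have h0 : 0 ≤ τ * a.2 := by positivity
    have h1 : τ * a.2 ≤ a.2 := by nlinarith
    have h2 : a.2 ≤ a.2 + δ := by linarith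
    have h3 : 0 ≤ (1 - τ) * a.2 := by nlinarith
    have h4 : 0 ≤ σ ^ 2 * (τ * a.2) := by positivity
    have h5 : 0 ≤ σ ^ 2 * ((1 - τ) * a.2) := by positivity
    have h6 : 0 ≤ σ ^ 2 * δ := by positivity
    convert h using 2
    · funext ω
      congr 3
      simp [Fin.sum_univ_three]
      ring
    · congr 3
      simp only [Fin.sum_univ_three, Matrix.cons_val, NNReal.coe_min, Real.coe_toNNReal _ h0,
        Real.coe_toNNReal _ ha.le, Real.coe_toNNReal _ (ha.le.trans h2), Real.coe_toNNReal _ h4,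
        Real.coe_toNNReal _ h5, Real.coe_toNNReal _ h6, min_self, min_eq_left h1, min_eq_right h1,
        min_eq_left h2, min_eq_right h2, min_eq_left (h1.trans h2), min_eq_right (h1.trans h2)]
      ring
  mulVec_stat g h a ω ha := by
    have h1 : τ * a.2 ≤ a.2 := by nlinarith
    have h2 : a.2 < a.2 + δ := by linarith
    funext k
    rw [threePrices, price_of_le hS₀.ne' _ _ _ _ _ h1, price_of_le hS₀.ne' _ _ _ _ _ le_rfl,
      price_of_lt hS₀.ne' _ _ _ _ _ h2]
    fin_cases k <;> simp [Matrix.mulVec, dotProduct, Fin.sum_univ_three] <;> ring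

/-- Permanent and realized impact form a Gaussian regression, in the coordinates `I - (3 / 2) J`
and `J`; the factor `3 / 2` is the regression coefficient `(T / 2) / (T / 3)` of `W_{T + δ}` on the
average of `W` over `[0, T]`. -/
lemma isGaussianRegression_impactPair [IsProbabilityMeasure μ] (hV : IsPreBrownianReal V μ)
    (hVm : ∀ s, Measurable (V s)) (hVc : ∀ ω, Continuous fun s => V s ω)
    {S₀ σ δ : ℝ} (hS₀ : 0 < S₀) (hσ : 0 < σ) (hδ : 0 < δ) :
    IsGaussianRegression μ V (impactPair S₀ σ δ) !![1, -(3 / 2); 0, 1]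
      ![fun T => T / 4, fun T => T / 2] ![fun _ => -(3 / 2), fun _ => 1]
      ![fun T => σ ^ 2 * (T / 4 + δ), fun T => σ ^ 2 * (T / 3)]
      (fun z => ![σ * (V (z.1.2 + δ).toNNReal z.2 -
          3 / 2 * ∫ s in (0 : ℝ)..1, V (s * z.1.2).toNNReal z.2),
        σ * ∫ s in (0 : ℝ)..1, V (s * z.1.2).toNNReal z.2]) where
  det_eq_one := by simp [Matrix.det_fin_two]
  continuous_α k := by fin_cases k <;> simp <;> fun_prop
  continuous_β k := by fin_cases k <;> simp <;> fun_prop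
  continuous_c k := by fin_cases k <;> simp <;> fun_prop
  c_pos k T hT := by fin_cases k <;> simp <;> positivity
  measurable_noise := by
    have h1 := measurable_process_comp hVm hVc (X := (ℝ × ℝ) × Ω) (t := fun z => z.1.2 + δ)
      (by fun_prop) measurable_snd
    have h2 : Measurable fun z : (ℝ × ℝ) × Ω => ∫ s in (0 : ℝ)..1, V (s * z.1.2).toNNReal z.2 := by
      simp_rw [intervalIntegral.integral_of_le zero_le_one]
      refine StronglyMeasurable.measurable (StronglyMeasurable.integral_prod_right
        (f := fun (z : (ℝ × ℝ) × Ω) (s : ℝ) => V (s * z.1.2).toNNReal z.2) ?_)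
      exact (measurable_process_comp hVm hVc (X := ((ℝ × ℝ) × Ω) × ℝ)
        (t := fun x => x.2 * x.1.1.2) (by fun_prop) (f := fun x => x.1.2)
        (by fun_prop)).stronglyMeasurable
    rw [measurable_pi_iff]
    intro k
    fin_cases k
    exacts [(h1.sub (h2.const_mul _)).const_mul σ, h2.const_mul σ]
  map_noise a ha := by
    have hA : Measurable fun ω => ∫ s in (0 : ℝ)..1, V (s * a.2).toNNReal ω := by
      simp_rw [intervalIntegral.integral_of_le zero_le_one]
      refine StronglyMeasurable.measurable (StronglyMeasurable.integral_prod_right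
        (f := fun (ω : Ω) (s : ℝ) => V (s * a.2).toNNReal ω) ?_)
      exact (measurable_process_comp hVm hVc (X := Ω × ℝ)
        (t := fun x => x.2 * a.2) (by fun_prop) (f := fun x => x.1)
        (by fun_prop)).stronglyMeasurable
    refine map_eq_pi_gaussianReal_of_charFun ?_ _ fun t => ?_
    · rw [measurable_pi_iff]
      intro k
      fin_cases k <;> simp <;> fun_prop
    have h := integral_exp_eval_add_average_brownian hV hVm hVc (S := a.2 + δ) ha.le (by linarith)
      (σ * t 0) (σ * (t 1 - 3 / 2 * t 0))
    have h1 : 0 ≤ σ ^ 2 * (a.2 / 4 + δ) := by positivity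
    have h2 : 0 ≤ σ ^ 2 * (a.2 / 3) := by positivity
    convert h using 2
    · funext ω
      congr 3
      simp [Fin.sum_univ_two]
      ring
    · congr 3
      simp only [Fin.sum_univ_two, Matrix.cons_val_zero, Matrix.cons_val_one,
        Real.coe_toNNReal _ h1, Real.coe_toNNReal _ h2]
      ring
  mulVec_stat g h a ω ha := by
    have h2 : a.2 < a.2 + δ := by linarith
    funext k
    rw [impactPair, permanentImpact, price_of_lt hS₀.ne' _ _ _ _ _ h2,
      realizedImpact_eq hS₀.ne' _ _ _ (hVc ω) _ ha]
    fin_cases k <;> simp [Matrix.mulVec, dotProduct, Fin.sum_univ_two]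
    ring

/-- Only the paths of the driving process up to a null set matter, so a Brownian motion may be replaced
by its continuous version. -/
lemma sampleLaw_congr [SFinite μ] {W : ℝ≥0 → Ω → ℝ} (hWV : ∀ᵐ ω ∂μ, ∀ s, W s ω = V s ω)
    (G : Measure (ℝ × ℝ)) {n : ℕ} (stat : (ℝ≥0 → ℝ) → ℝ → ℝ → Fin n → ℝ) :
    sampleLaw μ W G stat = sampleLaw μ V G stat := by
  refine Measure.map_congr ?_
  filter_upwards [Measure.quasiMeasurePreserving_snd.ae hWV] with z hz
  rw [funext hz]

end Experiments

/-! ### Comparison of the information matrices -/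

section Comparison

lemma isHermitian_regressionFisher {n K : ℕ} (α β c : Fin n → ℝ → ℝ)
    (g h : EuclideanSpace ℝ (Fin K) → ℝ → ℝ) (G : Measure (ℝ × ℝ))
    (θ : EuclideanSpace ℝ (Fin K)) :
    (regressionFisher α β c g h G θ).IsHermitian := by
  ext i j
  simp only [Matrix.conjTranspose_apply, regressionFisher, Matrix.of_apply, star_trivial]
  congr 1
  funext a
  exact Finset.sum_congr rfl fun k _ => by ring

variable {Ω : Type*} [MeasurableSpace Ω] {μ : Measure Ω} [IsProbabilityMeasure μ]
  {K : ℕ} {Θ : Set (EuclideanSpace ℝ (Fin K))} {g h : EuclideanSpace ℝ (Fin K) → ℝ → ℝ}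
  {G : Measure (ℝ × ℝ)} [IsProbabilityMeasure G]

/-- The quadratic form of the Fisher information matrix of a Gaussian regression is an average over
orders of quadratic forms in the directional derivatives of `g` and `h`. -/
lemma IsGaussianRegression.dotProduct_regressionFisher {V : ℝ≥0 → Ω → ℝ} {n : ℕ}
    {stat : (ℝ → ℝ) → (ℝ → ℝ) → (ℝ≥0 → ℝ) → ℝ → ℝ → Fin n → ℝ}
    {B : Matrix (Fin n) (Fin n) ℝ} {α β c : Fin n → ℝ → ℝ} {N : (ℝ × ℝ) × Ω → Fin n → ℝ}
    (hS : IsGaussianRegression μ V stat B α β c N) (hreg : RegularModel Θ g h G)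
    {θ : EuclideanSpace ℝ (Fin K)} (hθ : θ ∈ Θ) (x : Fin K → ℝ) :
    Integrable (fun a : ℝ × ℝ => ∑ k, (α k a.2 * ∑ i, x i * impactDeriv g θ i a.1 +
      β k a.2 * ∑ i, x i * impactDeriv h θ i a.1) ^ 2 / c k a.2) G ∧
    x ⬝ᵥ (regressionFisher α β c g h G θ).mulVec x =
      ∫ a : ℝ × ℝ, ∑ k, (α k a.2 * ∑ i, x i * impactDeriv g θ i a.1 +
        β k a.2 * ∑ i, x i * impactDeriv h θ i a.1) ^ 2 / c k a.2 ∂G := by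
  have hI := fun i j => (hS.integrable_and_integral_score_mul hreg hθ i j).2.1
  have hterm : ∀ i j, Integrable (fun a => x i * (fisherIntegrand α β c g h θ i j a * x j)) G :=
    fun i j => ((hI i j).mul_const _).const_mul _
  have heq : ∀ a : ℝ × ℝ, ∑ k, (α k a.2 * ∑ i, x i * impactDeriv g θ i a.1 +
      β k a.2 * ∑ i, x i * impactDeriv h θ i a.1) ^ 2 / c k a.2 =
      ∑ i, ∑ j, x i * (fisherIntegrand α β c g h θ i j a * x j) := by
    intro a
    simp_rw [fisherIntegrand, Finset.sum_mul, Finset.mul_sum]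
    rw [Finset.sum_congr rfl fun i _ => Finset.sum_comm, Finset.sum_comm]
    refine Finset.sum_congr rfl fun k _ => ?_
    rw [← Finset.sum_add_distrib, sq, Finset.sum_mul_sum, Finset.sum_div]
    refine Finset.sum_congr rfl fun i _ => ?_
    rw [Finset.sum_div]
    refine Finset.sum_congr rfl fun j _ => ?_
    ring
  simp_rw [heq]
  refine ⟨integrable_finsetSum _ fun i _ => integrable_finsetSum _ fun j _ => hterm i j, ?_⟩
  rw [integral_finsetSum _ fun i _ => integrable_finsetSum _ fun j _ => hterm i j]
  refine Finset.sum_congr rfl fun i _ => ?_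
  rw [integral_finsetSum _ fun j _ => hterm i j, Matrix.mulVec, dotProduct, Finset.mul_sum]
  refine Finset.sum_congr rfl fun j _ => ?_
  rw [integral_const_mul, integral_mul_const]
  rfl

/-- The difference of the two information forms of a single order, as a combination of two squares:
the second coefficient has the sign of `1 / 4 - τ`. -/
lemma informationForm_sub {σ δ τ T : ℝ} (hσ : 0 < σ) (hδ : 0 < δ) (hτ0 : 0 < τ) (hτ1 : τ < 1)
    (hT : 0 < T) (u w : ℝ) :
    ((τ * T * u + w) ^ 2 / (σ ^ 2 * (τ * T)) + ((1 - τ) * T * u) ^ 2 / (σ ^ 2 * ((1 - τ) * T)) +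
        w ^ 2 / (σ ^ 2 * δ)) -
      ((T / 4 * u - 3 / 2 * w) ^ 2 / (σ ^ 2 * (T / 4 + δ)) +
        (T / 2 * u + w) ^ 2 / (σ ^ 2 * (T / 3))) =
      (δ * T / (T + 4 * δ) * (u + (T - 2 * δ) / (δ * T) * w) ^ 2 +
        (1 / τ - 4) / T * w ^ 2) / σ ^ 2 := by
  have h1 : 1 - τ ≠ 0 := (sub_pos.2 hτ1).ne'
  have h2 : T + 4 * δ ≠ 0 := by positivity
  have h3 : T / 4 + δ = (T + 4 * δ) / 4 := by ring
  rw [h3]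
  field_simp
  ring

/-- If the information form of every single order is larger for one Gaussian regression than for
another, so is the Fisher information matrix. -/
lemma posSemidef_regressionFisher_sub {V : ℝ≥0 → Ω → ℝ} {n n' : ℕ}
    {stat : (ℝ → ℝ) → (ℝ → ℝ) → (ℝ≥0 → ℝ) → ℝ → ℝ → Fin n → ℝ}
    {B : Matrix (Fin n) (Fin n) ℝ} {α β c : Fin n → ℝ → ℝ} {N : (ℝ × ℝ) × Ω → Fin n → ℝ}
    {stat' : (ℝ → ℝ) → (ℝ → ℝ) → (ℝ≥0 → ℝ) → ℝ → ℝ → Fin n' → ℝ}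
    {B' : Matrix (Fin n') (Fin n') ℝ} {α' β' c' : Fin n' → ℝ → ℝ}
    {N' : (ℝ × ℝ) × Ω → Fin n' → ℝ}
    (hS : IsGaussianRegression μ V stat B α β c N)
    (hS' : IsGaussianRegression μ V stat' B' α' β' c' N') (hreg : RegularModel Θ g h G)
    (hle : ∀ T, 0 < T → ∀ u w : ℝ, ∑ k, (α' k T * u + β' k T * w) ^ 2 / c' k T ≤
      ∑ k, (α k T * u + β k T * w) ^ 2 / c k T)
    {θ : EuclideanSpace ℝ (Fin K)} (hθ : θ ∈ Θ) :
    (regressionFisher α β c g h G θ - regressionFisher α' β' c' g h G θ).PosSemidef := by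
  refine Matrix.PosSemidef.of_dotProduct_mulVec_nonneg
    ((isHermitian_regressionFisher α β c g h G θ).sub
      (isHermitian_regressionFisher α' β' c' g h G θ)) fun x => ?_
  obtain ⟨hi, he⟩ := hS.dotProduct_regressionFisher hreg hθ x
  obtain ⟨hi', he'⟩ := hS'.dotProduct_regressionFisher hreg hθ x
  rw [star_trivial, Matrix.sub_mulVec, dotProduct_sub, he, he', sub_nonneg]
  refine integral_mono_ae hi' hi ?_
  filter_upwards [hreg.ae_duration_pos] with a ha
  exact hle a.2 ha _ _

/-! ### The linear impact model in which the two coordinates of the parameter are `g` and `h` -/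

lemma impactDeriv_coord (θ : EuclideanSpace ℝ (Fin 2)) (l i : Fin 2) (v : ℝ) :
    impactDeriv (fun θ' _ => θ' l) θ i v = if l = i then 1 else 0 := by
  have h : HasFDerivAt (fun θ' : EuclideanSpace ℝ (Fin 2) => θ' l)
      (EuclideanSpace.proj l : EuclideanSpace ℝ (Fin 2) →L[ℝ] ℝ) θ :=
    (EuclideanSpace.proj l : EuclideanSpace ℝ (Fin 2) →L[ℝ] ℝ).hasFDerivAt
  rw [impactDeriv, h.fderiv]
  simp

lemma regularModel_coord (v₀ : ℝ) {T₀ : ℝ} (hT₀ : 0 < T₀) :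
    RegularModel (Set.univ : Set (EuclideanSpace ℝ (Fin 2))) (fun θ _ => θ 0) (fun θ _ => θ 1)
      (Measure.dirac (v₀, T₀)) where
  isOpen := isOpen_univ
  duration_bounds := ⟨T₀, T₀, hT₀, by simp [ae_dirac_eq]⟩
  measurable_g _ _ := measurable_const
  measurable_h _ _ := measurable_const
  contDiff_g := ae_of_all _ fun _ => ContDiff.contDiffOn (by fun_prop)
  contDiff_h := ae_of_all _ fun _ => ContDiff.contDiffOn (by fun_prop)
  lipschitz θ _ := by
    refine ⟨Set.univ, Filter.univ_mem, 1, ae_of_all _ fun _ θ₁ _ θ₂ _ => ?_⟩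
    rw [one_mul]
    exact ⟨PiLp.norm_apply_le (θ₁ - θ₂) 0, PiLp.norm_apply_le (θ₁ - θ₂) 1⟩

lemma identifiable_coord (v₀ T₀ : ℝ) :
    Identifiable (Set.univ : Set (EuclideanSpace ℝ (Fin 2))) (fun θ _ => θ 0) (fun θ _ => θ 1)
      (Measure.dirac (v₀, T₀)) := by
  intro θ₁ _ θ₂ _ hθ
  simp only [ae_dirac_eq, Filter.eventually_pure] at hθ
  ext i
  fin_cases i
  exacts [hθ.1, hθ.2]

lemma regressionFisher_coord {n : ℕ} (α β c : Fin n → ℝ → ℝ) (v₀ T₀ : ℝ)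
    (θ : EuclideanSpace ℝ (Fin 2)) :
    regressionFisher α β c (fun θ _ => θ 0) (fun θ _ => θ 1) (Measure.dirac (v₀, T₀)) θ =
      !![∑ k, α k T₀ ^ 2 / c k T₀, ∑ k, α k T₀ * β k T₀ / c k T₀;
        ∑ k, α k T₀ * β k T₀ / c k T₀, ∑ k, β k T₀ ^ 2 / c k T₀] := by
  ext i j
  rw [regressionFisher, Matrix.of_apply, integral_dirac]
  simp only [fisherIntegrand, impactDeriv_coord]
  fin_cases i <;> fin_cases j <;> simp [sq, mul_comm]

end Comparison

end AlmgrenChriss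

theorem theorem1 {Ω : Type*} [MeasurableSpace Ω] (μ : Measure Ω) [IsProbabilityMeasure μ]
    (W : ℝ≥0 → Ω → ℝ) (hW : IsBrownianReal W μ)
    (S₀ σ δ : ℝ) (hS₀ : 0 < S₀) (hσ : 0 < σ) (hδ : 0 < δ) :
    -- dominance for every sampling ratio `τ = t / T ≤ 1 / 4`
    (∀ (K : ℕ) (Θ : Set (EuclideanSpace ℝ (Fin K))) (g h : EuclideanSpace ℝ (Fin K) → ℝ → ℝ)
        (G : Measure (ℝ × ℝ)), IsProbabilityMeasure G → RegularModel Θ g h G →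
      ∀ τ : ℝ, 0 < τ → τ ≤ 1 / 4 → ∀ θ ∈ Θ,
        ∃ I₃ I₂ : Matrix (Fin K) (Fin K) ℝ,
          IsFisherThreePrices μ W S₀ σ δ τ G Θ g h θ I₃ ∧
          IsFisherImpactPair μ W S₀ σ δ G Θ g h θ I₂ ∧
          (I₃ - I₂).PosSemidef) ∧
    -- tightness: it fails for every ratio `τ > 1 / 4`, for some impact functions
    (∀ τ : ℝ, 1 / 4 < τ → τ < 1 → ∀ v₀ T₀ : ℝ, 0 < v₀ → 0 < T₀ →
      ∃ g h : EuclideanSpace ℝ (Fin 2) → ℝ → ℝ,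
        RegularModel Set.univ g h (Measure.dirac (v₀, T₀)) ∧
        Identifiable Set.univ g h (Measure.dirac (v₀, T₀)) ∧
        ∃ I₃ I₂ : Matrix (Fin 2) (Fin 2) ℝ,
          (∀ θ, IsFisherThreePrices μ W S₀ σ δ τ (Measure.dirac (v₀, T₀)) Set.univ g h θ I₃) ∧
          (∀ θ, IsFisherImpactPair μ W S₀ σ δ (Measure.dirac (v₀, T₀)) Set.univ g h θ I₂) ∧
          IsUnit I₃.det ∧ IsUnit I₂.det ∧ ¬ (I₃ - I₂).PosSemidef) := by
  obtain ⟨V, hVm, hVc, hWV⟩ := exists_measurable_continuous_version hW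
  have hV : IsPreBrownianReal V μ :=
    hW.toIsPreBrownianReal.congr fun s => hWV.mono fun ω hω => hω s
  have hS₂ := isGaussianRegression_impactPair hV hVm hVc hS₀ hσ hδ
  have hS₃ := fun (τ : ℝ) (hτ0 : 0 < τ) (hτ1 : τ < 1) =>
    isGaussianRegression_threePrices hV hVm hVc hS₀ hσ hδ hτ0 hτ1
  refine ⟨fun K Θ g h G hG hreg τ hτ0 hτ4 θ hθ => ?_, fun τ hτ4 hτ1 v₀ T₀ _ hT₀ => ?_⟩
  · have hτ1 : τ < 1 := by linarith
    refine ⟨_, _, ?_, ?_, posSemidef_regressionFisher_sub (hS₃ τ hτ0 hτ1) hS₂ hreg ?_ hθ⟩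
    · simp only [IsFisherThreePrices, sampleLaw_congr hWV]
      exact (hS₃ τ hτ0 hτ1).hasFisherInformation hreg hθ
    · simp only [IsFisherImpactPair, sampleLaw_congr hWV]
      exact hS₂.hasFisherInformation hreg hθ
    · intro T hT u w
      have hsub := informationForm_sub hσ hδ hτ0 hτ1 hT u w
      have hτ : 0 ≤ 1 / τ - 4 := by
        rw [sub_nonneg, le_div_iff₀ hτ0]
        linarith
      have hnn : 0 ≤ (δ * T / (T + 4 * δ) * (u + (T - 2 * δ) / (δ * T) * w) ^ 2 +
        (1 / τ - 4) / T * w ^ 2) / σ ^ 2 := by positivity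
      rw [← hsub, sub_nonneg] at hnn
      convert hnn using 1
      · simp [Fin.sum_univ_two]
        ring_nf
      · simp [Fin.sum_univ_three]
  · have hτ0 : 0 < τ := by linarith
    have hreg := regularModel_coord v₀ hT₀
    have h1τ : 0 < 1 - τ := sub_pos.2 hτ1
    have hdet₃ : (regressionFisher ![fun T => τ * T, fun T => (1 - τ) * T, fun _ => 0]
        ![fun _ => 1, fun _ => 0, fun _ => -1]
        ![fun T => σ ^ 2 * (τ * T), fun T => σ ^ 2 * ((1 - τ) * T), fun _ => σ ^ 2 * δ]
        (fun (θ : EuclideanSpace ℝ (Fin 2)) _ => θ 0) (fun θ _ => θ 1)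
        (Measure.dirac (v₀, T₀)) 0).det =
        (1 / τ + T₀ / δ - 1) / σ ^ 4 := by
      rw [regressionFisher_coord, Matrix.det_fin_two_of]
      simp [Fin.sum_univ_three]
      field_simp
      ring
    have hdet₂ : (regressionFisher ![fun T => T / 4, fun T => T / 2]
        ![fun _ => -(3 / 2), fun _ => 1] ![fun T => σ ^ 2 * (T / 4 + δ), fun T => σ ^ 2 * (T / 3)]
        (fun (θ : EuclideanSpace ℝ (Fin 2)) _ => θ 0) (fun θ _ => θ 1)
        (Measure.dirac (v₀, T₀)) 0).det =
        12 * T₀ / (T₀ + 4 * δ) / σ ^ 4 := by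
      rw [regressionFisher_coord, Matrix.det_fin_two_of]
      have h3 : T₀ / 4 + δ = (T₀ + 4 * δ) / 4 := by ring
      simp [Fin.sum_univ_two, h3]
      field_simp
      ring
    have hu₃ := hdet₃ ▸ isUnit_iff_ne_zero.2 (by
      have : 1 < 1 / τ := by rwa [lt_div_iff₀ hτ0, one_mul]
      have : 0 < T₀ / δ := by positivity
      exact (div_pos (by linarith) (by positivity)).ne' :
        (1 / τ + T₀ / δ - 1) / σ ^ 4 ≠ 0)
    have hu₂ := hdet₂ ▸ isUnit_iff_ne_zero.2 (by positivity : 12 * T₀ / (T₀ + 4 * δ) / σ ^ 4 ≠ 0)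
    refine ⟨fun θ _ => θ 0, fun θ _ => θ 1, hreg, identifiable_coord v₀ T₀, _, _,
      fun θ => ?_, fun θ => ?_, hu₃, hu₂, ?_⟩
    rotate_left 2
    · intro hpsd
      -- the vector at which the first square of `informationForm_sub` vanishes
      have h := hpsd.dotProduct_mulVec_nonneg ![2 * δ - T₀, δ * T₀]
      rw [star_trivial, Matrix.sub_mulVec, dotProduct_sub,
        ((hS₃ τ hτ0 hτ1).dotProduct_regressionFisher hreg (Set.mem_univ _) _).2,
        (hS₂.dotProduct_regressionFisher hreg (Set.mem_univ _) _).2, integral_dirac,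
        integral_dirac] at h
      have hsub := informationForm_sub hσ hδ hτ0 hτ1 hT₀ (2 * δ - T₀) (δ * T₀)
      have hneg : (δ * T₀ / (T₀ + 4 * δ) *
          (2 * δ - T₀ + (T₀ - 2 * δ) / (δ * T₀) * (δ * T₀)) ^ 2 +
          (1 / τ - 4) / T₀ * (δ * T₀) ^ 2) / σ ^ 2 < 0 := by
        have h1 : 1 / τ - 4 < 0 := by
          rw [sub_neg, div_lt_iff₀ hτ0]
          linarith
        rw [div_mul_cancel₀ _ (by positivity : δ * T₀ ≠ 0),
          show 2 * δ - T₀ + (T₀ - 2 * δ) = 0 by ring]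
        have h2 : (1 / τ - 4) / T₀ * (δ * T₀) ^ 2 < 0 :=
          mul_neg_of_neg_of_pos (div_neg_of_neg_of_pos h1 hT₀) (by positivity)
        exact div_neg_of_neg_of_pos (by linarith) (by positivity)
      rw [← hsub] at hneg
      refine absurd h (not_le.2 (lt_of_eq_of_lt ?_ hneg))
      simp [impactDeriv_coord, Fin.sum_univ_two, Fin.sum_univ_three]
      ring
    · simp only [IsFisherThreePrices, sampleLaw_congr hWV]
      have h := (hS₃ τ hτ0 hτ1).hasFisherInformation hreg (Set.mem_univ θ)
      rw [regressionFisher_coord _ _ _ _ _ θ, ← regressionFisher_coord _ _ _ _ _ 0] at h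
      exact h
    · simp only [IsFisherImpactPair, sampleLaw_congr hWV]
      have h := hS₂.hasFisherInformation hreg (Set.mem_univ θ)
      rw [regressionFisher_coord _ _ _ _ _ θ, ← regressionFisher_coord _ _ _ _ _ 0] at h
      exact h
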